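/- Setting. The input is a connected undirected graph $G=(V,E)$ on $n=|V|\ge 1$ vertices with maximum degree $\Delta$ and edge weights $w(e)\ge 0$. A 2-spanner of $G$ is a set $H\subseteq E$ such that for every edge $\{u,v\}\in E$ there is a path of length (number of edges) at most $2$ between $u$ and $v$ using edges of $H$ only; its cost is $w(H)=\sum_{e\in H}w(e)$. $W$ is the ratio between the maximum and the minimum positive edge weight ($W=1$ if no edge has positive weight). In the LOCAL model the vertices of $G$ carry distinct identifiers in $\mathbb N$, all run the same code, and communicate in synchronous rounds: in each round every vertex draws fresh private randomness, exchanges messages of unbounded size with its neighbors and updates its state (local computation is not restricted). Initially a vertex knows only its identifier, the identifiers of its neighbors, the weights of its incident edges, and a common upper bound $N\ge n$. Each vertex eventually terminates (it then sends no more messages) and outputs a subset of its incident edges; the output of the algorithm is the union of these sets. Write $\Delta'=\max(\Delta,2)$ and $n'=\max(n,2)$ (so $\Delta'=\Delta$ and $n'=n$ whenever $n\ge 3$). Theorem. There is a randomized LOCAL algorithm for the weighted 2-spanner problem such that: (1) there is an absolute constant $C$ such that for every input, every $N\ge n$ and every outcome of the random choices, all vertices terminate after finitely many rounds and the output $H$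 is a 2-spanner of $G$ with $w(H)\le C\log(\Delta')\cdot w(H^*)$ for every 2-spanner $H^*$ of $G$; (2) for every $k\in\mathbb N$ and every real $c\ge 1$ there is a constant $C_{k,c}$ such that for every input and every $N$ with $n\le N\le n^k$, with probability at least $1-n^{-c}$ all vertices have terminated within $C_{k,c}\cdot\log n'\cdot\log(\Delta' W)$ rounds. -/

import Mathlib

open MeasureTheory

noncomputable section

/-- A `k`-spanner of `G`, given by its edge set `H`: a set of edges of `G` such that every edge
`{u, v}` of `G` is covered by `H`, i.e. `u` and `v` are joined by a path of length at most `k`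
all of whose edges are in `H`. -/
def IsKSpanner {V : Type} (G : SimpleGraph V) (k : ℕ) (H : Finset (Sym2 V)) : Prop :=
  (H : Set (Sym2 V)) ⊆ G.edgeSet ∧
    ∀ u v : V, G.Adj u v →
      ∃ p : (SimpleGraph.fromEdgeSet (H : Set (Sym2 V))).Walk u v, p.IsPath ∧ p.length ≤ k

/-- An input of the weighted spanner problem in the distributed setting: a connected undirected
communication graph, distinct identifiers of its vertices, non-negative weights of its edges. -/
structure WeightedNetwork (V : Type) where
  graph : SimpleGraph V
  connected : graph.Connected
  ident : V → ℕ
  ident_injective : Function.Injective ident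
  /-- Only the values on edges of `graph` matter. -/
  weight : Sym2 V → ℝ
  weight_nonneg : ∀ e ∈ graph.edgeSet, 0 ≤ weight e

/-- What a vertex knows before the first round: an upper bound on the number of vertices, its own
identifier, and the pairs (identifier of the neighbor, weight of the edge to it), one for each of
its neighbors. -/
structure LocalInput where
  sizeBound : ℕ
  ident : ℕ
  incident : Finset (ℕ × ℝ)

/-- A randomized algorithm in the LOCAL model whose vertices output sets of incident edges.
All vertices run the same code.
Neither the states and messages nor the local computations are bounded. -/
structure LocalAlgorithm where
  State : Type
  Msg : Type
  /-- If the known bound on the number of vertices is `N`, then in every round every vertex draws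
  a fresh uniformly random number from `{0, …, coinMax N}`. -/
  coinMax : ℕ → ℕ
  init : LocalInput → State
  /-- `send s r i` is the message that a vertex in state `s` whose random number of this round
  is `r` sends to its neighbor with identifier `i`. -/
  send : State → ℕ → ℕ → Msg
  /-- `receive s r M` is the new state of a vertex in state `s` whose random number of this round
  is `r`, when `M` is the set of the pairs (identifier of the sender, message) it receives. -/
  receive : State → ℕ → Set (ℕ × Msg) → State
  /-- `none` while the vertex is running; `some S` when it has terminated with, as its output,
  the edges to its neighbors with identifiers in `S`. -/
  output : State → Option (Finset ℕ)

namespace WeightedNetwork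

variable {V : Type} [Fintype V] (net : WeightedNetwork V)

open Classical in
/-- The maximum vertex degree. -/
def maxDegree : ℕ := net.graph.maxDegree

/-- The cost of a set of edges. -/
def cost (H : Finset (Sym2 V)) : ℝ := ∑ e ∈ H, net.weight e

/-- The (finite) set of the positive edge weights. -/
def positiveWeights : Set ℝ := {x | 0 < x ∧ ∃ e ∈ net.graph.edgeSet, net.weight e = x}

open Classical in
/-- The ratio between the maximum and the minimum positive edge weight, and `1` if no edge has
positive weight. -/
def weightRatio : ℝ :=
  if net.positiveWeights.Nonempty then sSup net.positiveWeights / sInf net.positiveWeights else 1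

open Classical in
/-- The identifiers of the neighbors of `v`. -/
def neighborIdents (v : V) : Finset ℕ := (net.graph.neighborFinset v).image net.ident

open Classical in
/-- The initial knowledge of `v`, if the known bound on the number of vertices is `N`. -/
def localInput (N : ℕ) (v : V) : LocalInput where
  sizeBound := N
  ident := net.ident v
  incident := (net.graph.neighborFinset v).image fun u => (net.ident u, net.weight s(v, u))

end WeightedNetwork

namespace LocalAlgorithm

variable (A : LocalAlgorithm) {V : Type}

/-- The outcomes of the random draws: `ω (t, v)` is the number that `v` draws in round `t`
(rounds are numbered from `0`). -/
abbrev Coins (V : Type) (N : ℕ) : Type := ℕ × V → Fin (A.coinMax N + 1)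

/-- All the random numbers are independent and uniform. -/
def coinMeasure (V : Type) (N : ℕ) : Measure (A.Coins V N) :=
  Measure.infinitePi fun _ : ℕ × V => (PMF.uniformOfFintype (Fin (A.coinMax N + 1))).toMeasure

variable [Fintype V] (net : WeightedNetwork V) (N : ℕ) (ω : A.Coins V N)

/-- The state of each vertex after `t` synchronous rounds. In a round every vertex that has not
yet terminated sends a message to each of its neighbors and then updates its state; a vertex that
has terminated keeps its state (hence its output) and sends nothing. -/
def stateAfter : ℕ → V → A.State
  | 0 => fun v => A.init (net.localInput N v)
  | t + 1 => fun v =>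
      if (A.output (stateAfter t v)).isSome then stateAfter t v
      else A.receive (stateAfter t v) (ω (t, v) : ℕ)
        {p | ∃ u : V, net.graph.Adj v u ∧ A.output (stateAfter t u) = none ∧
          p = (net.ident u, A.send (stateAfter t u) (ω (t, u) : ℕ) (net.ident v))}

/-- Every vertex has terminated within the first `t` rounds. -/
def AllTerminated (t : ℕ) : Prop :=
  ∀ v : V, (A.output (A.stateAfter net N ω t v)).isSome

/-- Every output present after `t` rounds is a set of edges incident to the vertex. -/
def OutputsIncident (t : ℕ) : Prop :=
  ∀ (v : V) (S : Finset ℕ), A.output (A.stateAfter net N ω t v) = some S →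
    S ⊆ net.neighborIdents v

open Classical in
/-- The union of the sets of edges that have been output within the first `t` rounds. -/
def outputEdges (t : ℕ) : Finset (Sym2 V) :=
  Finset.univ.filter fun e => ∃ (u v : V) (S : Finset ℕ),
    A.output (A.stateAfter net N ω t u) = some S ∧ net.ident v ∈ S ∧ e = s(u, v)

end LocalAlgorithm

end

/-!
The algorithm is a distributed greedy algorithm. A star with center `v` 2-spans the edges both of
whose ends lie in it; its density is the number of yet uncovered edges that it 2-spans, divided by
its weight. In each iteration every vertex `v` proposes a star whose density is within a factor `2`
of the greatest one, which lies between `2 ^ j` and `2 ^ (j + 1)` for the level `j` of `v`. An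
uncovered edge supports, among the proposals that 2-span it, the first one in a random order, but
only if no vertex that could 2-span this edge has a higher level. A star is taken if at least one
eighth of the uncovered edges that it 2-spans support it. Edges of weight `0` are taken at the
start, and a vertex terminates when no edge in its closed neighborhood is uncovered.

*Approximation.* A star that is taken is paid for by its supporters. Since a supporter sees no
higher level, it pays at most a constant times what it would pay for any other star 2-spanning it,
if the weight of that star were shared evenly by the uncovered edges that it 2-spans. Comparing with
the stars of a given 2-spanner yields a harmonic sum (`sum_starWeight_nextState_le`,
`sum_starWeight_run_le_cost`). This holds for all outcomes of the random choices, and so does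
termination, because the first vertex of the highest level always gets its star
(`card_uncovered_lt`).

*Running time.* The number of edges of `U` that a star 2-spans is supermodular in its set of leaves.
Hence, if `v` proposes the smallest star that maximizes this number minus `2 ^ j` times the weight,
then the star proposed for the level `j` can only shrink while more and more edges become covered
(`LocalInput.star_mono`), and no memory is needed to keep the proposals of one level consistent. So
for each level the number of incidences between uncovered edges and proposed stars is monotone. At
the highest level present it drops in expectation by a constant factor, by a voting argument: given
that `e` supports `v`, each edge of the star of `v` that lies in no more stars than `e`
supports `v` with probability at least about `1 / 2` (`le_card_winning`, `le_sum_won`). The sum over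
all levels, weighted by powers of a number `B` that exceeds all numbers of incidences, is a
potential with expected decrease by a constant factor in every iteration
(`sum_potential_nextState_le`), and its initial value is at most `B ^ K`, where the number `K` of levels is `O(log (Δ W))` (`exists_levels`). Markov's
inequality then bounds the probability that an edge is left after `O(K log n)` iterations
(`measureReal_uncovered_nonempty_le`).

*Implementation.* An iteration takes four rounds, in which the vertices send their whole state to
their neighbors; `sync_states` relates the states of the vertices to the global process.
-/

/-! ### Stars and their densities -/

noncomputable section

namespace LocalInput

variable (I : LocalInput)

/-- The identifiers of the neighbors. -/
def nbrs : Finset ℕ := I.incident.image Prod.fst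

/-- The total weight of the edges to the neighbors in `S`. -/
def starWeight (S : Finset ℕ) : ℝ := ∑ p ∈ I.incident with p.1 ∈ S, p.2

/-- The edges of `U` that are 2-spanned by the star with leaves `S`: those with both ends in the
star. These are the edges of the star itself and the edges between two leaves. -/
def spanned (S : Finset ℕ) (U : Finset (Sym2 ℕ)) : Finset (Sym2 ℕ) :=
  U ∩ (insert I.ident S).sym2

/-- The edges of `U` in the closed neighborhood: those that some star of the vertex 2-spans. -/
def near (U : Finset (Sym2 ℕ)) : Finset (Sym2 ℕ) := I.spanned I.nbrs U

/-- The greatest density (number of spanned edges of `U` per unit of weight) of a star. A star of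
weight `0` has density `0` here; this is harmless, because such a star never spans an edge that
is still uncovered. -/
def density (U : Finset (Sym2 ℕ)) : ℝ :=
  I.nbrs.powerset.sup' ⟨∅, Finset.empty_mem_powerset _⟩
    fun S => ((I.spanned S U).card : ℝ) / I.starWeight S

/-- The integer `j` with `2 ^ j < density ≤ 2 ^ (j + 1)`. -/
def level (U : Finset (Sym2 ℕ)) : ℤ := Int.clog 2 (I.density U) - 1

/-- How much the number of spanned edges exceeds the one required for density `2 ^ j`. -/
def surplus (U : Finset (Sym2 ℕ)) (j : ℤ) (S : Finset ℕ) : ℝ :=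
  ((I.spanned S U).card : ℝ) - 2 ^ j * I.starWeight S

/-- Among the stars of greatest surplus there is one with the fewest leaves. -/
theorem exists_star (U : Finset (Sym2 ℕ)) (j : ℤ) :
    ∃ S ⊆ I.nbrs, (∀ T ⊆ I.nbrs, I.surplus U j T ≤ I.surplus U j S) ∧
      ∀ T ⊆ I.nbrs, I.surplus U j S ≤ I.surplus U j T → S.card ≤ T.card := by
  classical
  obtain ⟨S₀, hS₀, hmax⟩ := Finset.exists_max_image I.nbrs.powerset (I.surplus U j)
    ⟨∅, Finset.empty_mem_powerset _⟩
  obtain ⟨S, hS, hmin⟩ := Finset.exists_min_image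
    (I.nbrs.powerset.filter fun S => I.surplus U j S₀ ≤ I.surplus U j S) Finset.card
    ⟨S₀, by simpa using hS₀⟩
  rw [Finset.mem_filter, Finset.mem_powerset] at hS
  refine ⟨S, hS.1, fun T hT => (hmax T (Finset.mem_powerset.2 hT)).trans hS.2, fun T hT h => ?_⟩
  exact hmin T (Finset.mem_filter.2 ⟨Finset.mem_powerset.2 hT, hS.2.trans h⟩)

/-- The smallest star of greatest surplus. -/
def star (U : Finset (Sym2 ℕ)) (j : ℤ) : Finset ℕ := (I.exists_star U j).choose

variable {I} {U U' : Finset (Sym2 ℕ)} {j : ℤ} {S T : Finset ℕ}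

theorem star_subset : I.star U j ⊆ I.nbrs := (I.exists_star U j).choose_spec.1

theorem surplus_le_star (hT : T ⊆ I.nbrs) : I.surplus U j T ≤ I.surplus U j (I.star U j) :=
  (I.exists_star U j).choose_spec.2.1 T hT

theorem card_star_le (hT : T ⊆ I.nbrs) (h : I.surplus U j (I.star U j) ≤ I.surplus U j T) :
    (I.star U j).card ≤ T.card :=
  (I.exists_star U j).choose_spec.2.2 T hT h

theorem mem_spanned {e : Sym2 ℕ} :
    e ∈ I.spanned S U ↔ e ∈ U ∧ ∀ x ∈ e, x ∈ insert I.ident S := by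
  rw [spanned, Finset.mem_inter, Finset.mem_sym2_iff]

theorem spanned_subset : I.spanned S U ⊆ U := Finset.inter_subset_left

theorem spanned_mono (hS : S ⊆ T) (hU : U ⊆ U') : I.spanned S U ⊆ I.spanned T U' := by
  intro e he
  rw [mem_spanned] at he ⊢
  exact ⟨hU he.1, fun x hx => Finset.insert_subset_insert _ hS (he.2 x hx)⟩

theorem near_mono (hU : U ⊆ U') : I.near U ⊆ I.near U' := spanned_mono subset_rfl hU

theorem near_subset : I.near U ⊆ U := spanned_subset

theorem spanned_near (hS : S ⊆ I.nbrs) : I.spanned S (I.near U) = I.spanned S U := by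
  ext e
  simp only [near, mem_spanned]
  exact ⟨fun h => ⟨h.1.1, h.2⟩, fun h => ⟨⟨h.1, fun x hx =>
    Finset.insert_subset_insert _ hS (h.2 x hx)⟩, h.2⟩⟩

theorem starWeight_union_add_inter (S T : Finset ℕ) :
    I.starWeight (S ∪ T) + I.starWeight (S ∩ T) = I.starWeight S + I.starWeight T := by
  classical
  have h1 : I.incident.filter (fun p => p.1 ∈ S ∪ T) =
      I.incident.filter (fun p => p.1 ∈ S) ∪ I.incident.filter (fun p => p.1 ∈ T) := by
    ext; simp; tauto
  have h2 : I.incident.filter (fun p => p.1 ∈ S ∩ T) =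
      I.incident.filter (fun p => p.1 ∈ S) ∩ I.incident.filter (fun p => p.1 ∈ T) := by
    ext; simp; tauto
  rw [starWeight, starWeight, h1, h2, Finset.sum_union_inter, starWeight, starWeight]

/-- The number of spanned edges is supermodular, even if the left side is counted in a bigger set
of edges. -/
theorem card_spanned_add_le (hU : U' ⊆ U) (S T : Finset ℕ) :
    (I.spanned S U).card + (I.spanned T U').card ≤
      (I.spanned (S ∪ T) U).card + (I.spanned (S ∩ T) U').card := by
  classical
  have h1 : I.spanned S U ∪ I.spanned T U' ⊆ I.spanned (S ∪ T) U :=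
    Finset.union_subset (spanned_mono Finset.subset_union_left subset_rfl)
      (spanned_mono Finset.subset_union_right hU)
  have h2 : I.spanned S U ∩ I.spanned T U' ⊆ I.spanned (S ∩ T) U' := by
    intro e he
    simp only [Finset.mem_inter, mem_spanned, Finset.mem_insert] at he ⊢
    refine ⟨he.2.1, fun x hx => ?_⟩
    have := he.1.2 x hx
    have := he.2.2 x hx
    tauto
  have := Finset.card_union_add_card_inter (I.spanned S U) (I.spanned T U')
  have := Finset.card_le_card h1
  have := Finset.card_le_card h2
  omega

/-- The chosen star shrinks with the set of uncovered edges. This is what makes the number of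
edges spanned by the chosen stars a potential function. -/
theorem star_mono (hU : U' ⊆ U) : I.star U' j ⊆ I.star U j := by
  classical
  have hs := card_spanned_add_le (I := I) hU (I.star U j) (I.star U' j)
  have hw := starWeight_union_add_inter (I := I) (I.star U j) (I.star U' j)
  -- by supermodularity, `star U j ∩ star U' j` also has the greatest surplus with respect to `U'`
  have hm : I.surplus U j (I.star U j ∪ I.star U' j) ≤ I.surplus U j (I.star U j) :=
    surplus_le_star (Finset.union_subset star_subset star_subset)
  have hle : I.surplus U' j (I.star U' j) ≤ I.surplus U' j (I.star U j ∩ I.star U' j) := by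
    have hs' : ((I.spanned (I.star U j) U).card : ℝ) + (I.spanned (I.star U' j) U').card ≤
      (I.spanned (I.star U j ∪ I.star U' j) U).card +
        (I.spanned (I.star U j ∩ I.star U' j) U').card := by exact_mod_cast hs
    have hw' := congrArg (fun x => (2 : ℝ) ^ j * x) hw
    simp only [mul_add] at hw'
    simp only [surplus] at hm ⊢
    linarith
  have hc := card_star_le (Finset.inter_subset_left.trans star_subset) hle
  have := Finset.eq_of_subset_of_card_le Finset.inter_subset_right hc
  exact Finset.inter_eq_right.1 this

/-- `I` is regular for `U` if its weights are non-negative, `U` has no loop at the vertex, and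
every star that spans an edge of `U` has positive weight. -/
structure Regular (I : LocalInput) (U : Finset (Sym2 ℕ)) : Prop where
  nonneg : ∀ p ∈ I.incident, 0 ≤ p.2
  spanned_empty : I.spanned ∅ U = ∅
  pos : ∀ S ⊆ I.nbrs, (I.spanned S U).Nonempty → 0 < I.starWeight S

theorem Regular.mono (h : I.Regular U) (hU : U' ⊆ U) : I.Regular U' where
  nonneg := h.nonneg
  spanned_empty := Finset.subset_empty.1 (h.spanned_empty ▸ spanned_mono subset_rfl hU)
  pos S hS hne := h.pos S hS (hne.mono (spanned_mono subset_rfl hU))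

theorem Regular.starWeight_nonneg (h : I.Regular U) (S : Finset ℕ) : 0 ≤ I.starWeight S :=
  Finset.sum_nonneg fun p hp => h.nonneg p (Finset.mem_filter.1 hp).1

theorem le_density (hS : S ⊆ I.nbrs) :
    ((I.spanned S U).card : ℝ) / I.starWeight S ≤ I.density U :=
  Finset.le_sup' (fun S => ((I.spanned S U).card : ℝ) / I.starWeight S)
    (Finset.mem_powerset.2 hS)

theorem Regular.density_pos (h : I.Regular U) (hU : (I.near U).Nonempty) : 0 < I.density U := by
  refine lt_of_lt_of_le (div_pos ?_ (h.pos _ subset_rfl hU)) (le_density subset_rfl)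
  exact_mod_cast Finset.card_pos.2 hU

theorem density_le : I.density U ≤ 2 ^ (I.level U + 1) := by
  rw [level, sub_add_cancel]
  exact_mod_cast Int.self_le_zpow_clog (b := 2) (by norm_num) (I.density U)

theorem Regular.lt_density (h : I.Regular U) (hU : (I.near U).Nonempty) :
    (2 : ℝ) ^ I.level U < I.density U := by
  exact_mod_cast Int.zpow_pred_clog_lt_self (b := 2) (by norm_num) (h.density_pos hU)

theorem Regular.card_spanned_le (h : I.Regular U) (hS : S ⊆ I.nbrs) :
    ((I.spanned S U).card : ℝ) ≤ 2 ^ (I.level U + 1) * I.starWeight S := by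
  rcases (I.spanned S U).eq_empty_or_nonempty with h0 | h0
  · rw [h0]
    have := h.starWeight_nonneg S
    simp only [Finset.card_empty, Nat.cast_zero]
    positivity
  · rw [← div_le_iff₀ (h.pos S hS h0)]
    exact (le_density hS).trans density_le

theorem Regular.surplus_empty (h : I.Regular U) : I.surplus U j ∅ = 0 := by
  simp [surplus, h.spanned_empty, starWeight]

theorem Regular.weight_star_le (h : I.Regular U) :
    2 ^ j * I.starWeight (I.star U j) ≤ (I.spanned (I.star U j) U).card := by
  have := surplus_le_star (I := I) (U := U) (j := j) (Finset.empty_subset I.nbrs)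
  rw [h.surplus_empty, surplus] at this
  linarith

theorem Regular.spanned_star_nonempty (h : I.Regular U) (hU : (I.near U).Nonempty) :
    (I.spanned (I.star U (I.level U)) U).Nonempty := by
  obtain ⟨S, hS, hS'⟩ := Finset.exists_mem_eq_sup' (s := I.nbrs.powerset)
    ⟨∅, Finset.empty_mem_powerset _⟩ fun S => ((I.spanned S U).card : ℝ) / I.starWeight S
  have hlt := h.lt_density hU
  have hpos := h.density_pos hU
  rw [Finset.mem_powerset] at hS
  change I.density U = _ at hS'
  rw [hS'] at hlt hpos
  have hne : (I.spanned S U).Nonempty := by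
    rw [← Finset.card_pos, Nat.pos_iff_ne_zero]
    intro h0
    simp [h0] at hpos
  rw [lt_div_iff₀ (h.pos S hS hne)] at hlt
  have hle := surplus_le_star (I := I) (U := U) (j := I.level U) hS
  have hw := h.starWeight_nonneg (I.star U (I.level U))
  have h2 : (0 : ℝ) ≤ 2 ^ (I.level U) * I.starWeight (I.star U (I.level U)) := by positivity
  rw [← Finset.card_pos]
  simp only [surplus] at hle
  have : (0 : ℝ) < (I.spanned (I.star U (I.level U)) U).card := by linarith
  exact_mod_cast this

/-- Above the level of the vertex, no star has positive surplus. -/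
theorem Regular.spanned_star_eq_empty (h : I.Regular U) (hj : I.level U < j) :
    I.spanned (I.star U j) U = ∅ := by
  have hle : I.surplus U j (I.star U j) ≤ 0 := by
    have h1 := h.card_spanned_le (star_subset (I := I) (U := U) (j := j))
    have h2 : (2 : ℝ) ^ (I.level U + 1) ≤ 2 ^ j := zpow_le_zpow_right₀ (by norm_num) (by omega)
    have h3 := mul_le_mul_of_nonneg_right h2 (h.starWeight_nonneg (I.star U j))
    simp only [surplus]
    linarith
  have hc := card_star_le (I := I) (U := U) (j := j) (Finset.empty_subset _)
    (by rwa [h.surplus_empty])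
  rw [Finset.card_empty, Nat.le_zero, Finset.card_eq_zero] at hc
  rw [hc, h.spanned_empty]

end LocalInput
end

/-! ### Random priorities and voting -/

noncomputable section

section Priorities

variable {V : Type} (m : ℕ) (ident : V → ℕ)

/-- With the random numbers `r`, the vertex `v` comes first among the vertices in `A`; ties are
broken by the identifiers. -/
def IsFirst (r : V → ℕ) (A : Finset V) (v : V) : Prop :=
  ∀ x ∈ A, toLex (r v, ident v) ≤ toLex (r x, ident x)

variable {ident} in
theorem IsFirst.unique (hi : Function.Injective ident) {r : V → ℕ} {A : Finset V} {v x : V}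
    (hv : IsFirst ident r A v) (hx : IsFirst ident r A x) (hvA : v ∈ A) (hxA : x ∈ A) :
    v = x := by
  have := le_antisymm (hv x hxA) (hx v hvA)
  exact hi (Prod.ext_iff.1 (toLex.injective this)).2

variable {ident} in
theorem exists_isFirst (r : V → ℕ) {A : Finset V} (hA : A.Nonempty) :
    ∃ v ∈ A, IsFirst ident r A v :=
  Finset.exists_min_image A (fun x => toLex (r x, ident x)) hA

variable [Fintype V]

open Classical in
/-- The outcomes in which the random number of `v` is smaller than all others in `A`. -/
def strictlyFirst (A : Finset V) (v : V) : Finset (V → Fin m) :=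
  Finset.univ.filter fun r => ∀ x ∈ A, x ≠ v → r v < r x

open Classical in
/-- The outcomes in which `v` comes first in `A`. -/
def firstOutcomes (A : Finset V) (v : V) : Finset (V → Fin m) :=
  Finset.univ.filter fun r => IsFirst ident (fun x => (r x : ℕ)) A v

variable {m ident}

/-- Exchanging two coordinates shows that all vertices of `A` are equally likely to come strictly
first. -/
theorem card_strictlyFirst_eq {A : Finset V} {v u : V} (hv : v ∈ A) (hu : u ∈ A) :
    (strictlyFirst m A v).card = (strictlyFirst m A u).card := by
  classical
  have key : ∀ v u : V, v ∈ A → u ∈ A →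
      ∀ r ∈ strictlyFirst m A v, r ∘ Equiv.swap v u ∈ strictlyFirst m A u := by
    intro v u hv hu r hr
    simp only [strictlyFirst, Finset.mem_filter, Finset.mem_univ, true_and] at hr ⊢
    intro x hx hxu
    simp only [Function.comp, Equiv.swap_apply_right]
    apply hr
    · by_cases h1 : x = v
      · subst h1; simpa using hu
      · rw [Equiv.swap_apply_of_ne_of_ne h1 hxu]; exact hx
    · intro h
      rw [Equiv.swap_apply_eq_iff, Equiv.swap_apply_left] at h
      exact hxu h
  refine Finset.card_bij' (fun r _ => r ∘ Equiv.swap v u) (fun r _ => r ∘ Equiv.swap v u)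
    (fun r hr => key v u hv hu r hr) (fun r hr => ?_) (fun r _ => ?_) (fun r _ => ?_)
  · have := key u v hu hv r hr
    rwa [Equiv.swap_comm] at this
  · ext x; simp
  · ext x; simp

/-- Two given random numbers coincide with probability `1 / m`. -/
theorem card_collision [DecidableEq V] {v x : V} (h : x ≠ v) :
    m * (Finset.univ.filter fun r : V → Fin m => r x = r v).card = m ^ Fintype.card V := by
  have h1 : (Finset.univ : Finset (V → Fin m)).card = m ^ Fintype.card V := by simp
  have h2 : m = (Finset.univ : Finset (Fin m)).card := by simp
  rw [← h1]
  nth_rewrite 1 [h2]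
  rw [← Finset.card_product]
  refine Finset.card_bij' (fun p _ => Function.update p.2 x p.1)
    (fun r _ => (r x, Function.update r x (r v))) ?_ ?_ ?_ ?_
  · intro p _; simp
  · intro r _
    simp [Function.update_of_ne h.symm]
  · rintro ⟨y, r⟩ hr
    simp only [Finset.mem_product, Finset.mem_univ, Finset.mem_filter, true_and] at hr
    simp [Function.update_of_ne h.symm, ← hr]
  · intro r _; simp

theorem strictlyFirst_subset (A : Finset V) (v : V) :
    strictlyFirst m A v ⊆ firstOutcomes m ident A v := by
  intro r hr
  simp only [strictlyFirst, firstOutcomes, Finset.mem_filter, Finset.mem_univ, true_and] at hr ⊢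
  intro x hx
  by_cases h : x = v
  · subst h; exact le_rfl
  · exact Prod.Lex.toLex_le_toLex.2 (Or.inl (hr x hx h))

theorem card_mul_strictlyFirst {A : Finset V} {v : V} (hv : v ∈ A) :
    A.card * (strictlyFirst m A v).card = ∑ u ∈ A, (strictlyFirst m A u).card := by
  rw [Finset.sum_congr rfl fun u hu => card_strictlyFirst_eq hu hv, Finset.sum_const, smul_eq_mul]

/-- Each vertex of `A` comes first with probability at most about `1 / |A|`. -/
theorem card_mul_firstOutcomes_le {A : Finset V} {v : V} (hv : v ∈ A) (hm : 0 < m) :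
    (A.card : ℝ) * (firstOutcomes m ident A v).card ≤
      (m : ℝ) ^ Fintype.card V * (1 + (A.card : ℝ) ^ 2 / m) := by
  classical
  have h1 : A.card * (strictlyFirst m A v).card ≤ m ^ Fintype.card V := by
    rw [card_mul_strictlyFirst hv, ← Finset.card_biUnion]
    · exact (Finset.card_le_univ _).trans (by simp)
    · intro x hx y hy hxy
      rw [Function.onFun, Finset.disjoint_left]
      intro r hr hr'
      simp only [strictlyFirst, Finset.mem_filter, Finset.mem_univ, true_and] at hr hr'
      exact lt_asymm (hr y hy hxy.symm) (hr' x hx hxy)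
  have h2 : firstOutcomes m ident A v ⊆ strictlyFirst m A v ∪
      (A.erase v).biUnion fun x => Finset.univ.filter fun r : V → Fin m => r x = r v := by
    intro r hr
    simp only [strictlyFirst, firstOutcomes, Finset.mem_filter, Finset.mem_univ, true_and,
      Finset.mem_union, Finset.mem_biUnion, Finset.mem_erase] at hr ⊢
    by_contra hcon
    push Not at hcon
    obtain ⟨⟨x, hx, hxv, hle⟩, hne⟩ := hcon
    have h3 := hr x hx
    rw [Prod.Lex.toLex_le_toLex] at h3
    have h4 := hne x ⟨hxv, hx⟩
    rcases h3 with h3 | ⟨h3, -⟩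
    · exact absurd hle (not_le.2 (by exact_mod_cast h3))
    · exact h4 (Fin.ext h3.symm)
  have h3 : m * (firstOutcomes m ident A v).card ≤
      m * (strictlyFirst m A v).card + A.card * m ^ Fintype.card V := by
    calc m * (firstOutcomes m ident A v).card
        ≤ m * ((strictlyFirst m A v).card + ∑ x ∈ A.erase v,
            (Finset.univ.filter fun r : V → Fin m => r x = r v).card) := by
          gcongr
          exact (Finset.card_le_card h2).trans ((Finset.card_union_le _ _).trans
            (by gcongr; exact Finset.card_biUnion_le))
      _ = m * (strictlyFirst m A v).card + (A.erase v).card * m ^ Fintype.card V := by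
          rw [mul_add, Finset.mul_sum, Finset.sum_congr rfl fun x hx =>
            card_collision (m := m) (Finset.ne_of_mem_erase hx), Finset.sum_const, smul_eq_mul]
      _ ≤ _ := by gcongr; exact Finset.erase_subset _ _
  have h1' : (A.card : ℝ) * (strictlyFirst m A v).card ≤ (m : ℝ) ^ Fintype.card V := by
    exact_mod_cast h1
  have h3' : (m : ℝ) * (firstOutcomes m ident A v).card ≤
      m * (strictlyFirst m A v).card + A.card * (m : ℝ) ^ Fintype.card V := by exact_mod_cast h3
  have hm' : (0 : ℝ) < m := by exact_mod_cast hm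
  have h4 : ((firstOutcomes m ident A v).card : ℝ) ≤
      (strictlyFirst m A v).card + A.card * (m : ℝ) ^ Fintype.card V / m := by
    rw [← sub_nonneg]
    have : (0 : ℝ) ≤ (m * (strictlyFirst m A v).card + A.card * (m : ℝ) ^ Fintype.card V
      - m * (firstOutcomes m ident A v).card) / m := by
      apply div_nonneg _ hm'.le
      linarith
    have h5 : (m * (strictlyFirst m A v).card + A.card * (m : ℝ) ^ Fintype.card V
      - m * (firstOutcomes m ident A v).card : ℝ) / m = (strictlyFirst m A v).card +
        A.card * (m : ℝ) ^ Fintype.card V / m - (firstOutcomes m ident A v).card := by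
      field_simp
    linarith
  calc (A.card : ℝ) * (firstOutcomes m ident A v).card
      ≤ A.card * ((strictlyFirst m A v).card + A.card * (m : ℝ) ^ Fintype.card V / m) := by gcongr
    _ = A.card * (strictlyFirst m A v).card +
          (m : ℝ) ^ Fintype.card V * ((A.card : ℝ) ^ 2 / m) := by ring
    _ ≤ _ := by rw [mul_add, mul_one]; gcongr

/-- Each vertex of `A` comes first with probability at least about `1 / |A|`. -/
theorem le_card_mul_firstOutcomes {A : Finset V} {v : V} (hv : v ∈ A) (hm : 0 < m) :
    (m : ℝ) ^ Fintype.card V * (1 - (A.card : ℝ) ^ 2 / m) ≤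
      (A.card : ℝ) * (firstOutcomes m ident A v).card := by
  classical
  have h1 : (Finset.univ : Finset (V → Fin m)) ⊆ (A.biUnion fun u => strictlyFirst m A u) ∪
      A.offDiag.biUnion fun p => Finset.univ.filter fun r : V → Fin m => r p.1 = r p.2 := by
    intro r _
    obtain ⟨u, hu, hmin⟩ := Finset.exists_min_image A r ⟨v, hv⟩
    simp only [strictlyFirst, Finset.mem_filter, Finset.mem_univ, true_and,
      Finset.mem_union, Finset.mem_biUnion, Finset.mem_offDiag]
    by_cases h : ∀ x ∈ A, x ≠ u → r u < r x
    · exact Or.inl ⟨u, hu, h⟩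
    · push Not at h
      obtain ⟨x, hx, hxu, hle⟩ := h
      exact Or.inr ⟨(x, u), ⟨hx, hu, hxu⟩, le_antisymm hle (hmin x hx)⟩
  have h2 : m * m ^ Fintype.card V ≤ m * (A.card * (strictlyFirst m A v).card) +
      A.card ^ 2 * m ^ Fintype.card V := by
    calc m * m ^ Fintype.card V = m * (Finset.univ : Finset (V → Fin m)).card := by simp
      _ ≤ m * (∑ u ∈ A, (strictlyFirst m A u).card + ∑ p ∈ A.offDiag,
            (Finset.univ.filter fun r : V → Fin m => r p.1 = r p.2).card) := by
          gcongr
          exact (Finset.card_le_card h1).trans ((Finset.card_union_le _ _).trans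
            (add_le_add Finset.card_biUnion_le Finset.card_biUnion_le))
      _ = m * (A.card * (strictlyFirst m A v).card) +
            A.offDiag.card * m ^ Fintype.card V := by
          rw [mul_add, Finset.mul_sum A.offDiag, Finset.sum_congr rfl fun p hp =>
            card_collision (m := m) (Finset.mem_offDiag.1 hp).2.2, Finset.sum_const, smul_eq_mul,
            card_mul_strictlyFirst hv]
      _ ≤ _ := by
          gcongr
          rw [Finset.offDiag_card, sq]
          exact Nat.sub_le _ _
  have hm' : (0 : ℝ) < m := by exact_mod_cast hm
  have h2' : (m : ℝ) * (m : ℝ) ^ Fintype.card V ≤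
      m * (A.card * (strictlyFirst m A v).card) + (A.card : ℝ) ^ 2 * (m : ℝ) ^ Fintype.card V := by
    exact_mod_cast h2
  have h3 : (m : ℝ) ^ Fintype.card V * (1 - (A.card : ℝ) ^ 2 / m) ≤
      A.card * (strictlyFirst m A v).card := by
    have : (m : ℝ) ^ Fintype.card V * (1 - (A.card : ℝ) ^ 2 / m) =
      (m * (m : ℝ) ^ Fintype.card V - (A.card : ℝ) ^ 2 * (m : ℝ) ^ Fintype.card V) / m := by
      field_simp
    rw [this, div_le_iff₀ hm']
    linarith
  refine h3.trans ?_
  gcongr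
  exact strictlyFirst_subset A v

end Priorities

section Voting

open Classical in
/-- At least half of the elements of `D` have a value of `d` that is not smaller than that of half
of the elements. -/
theorem card_le_two_mul_card_frequent {ε : Type} (D : Finset ε) (d : ε → ℕ) :
    D.card ≤ 2 * (D.filter fun e => D.card ≤ 2 * (D.filter fun e' => d e' ≤ d e).card).card := by
  set bad := D.filter fun e => ¬ D.card ≤ 2 * (D.filter fun e' => d e' ≤ d e).card with hbad
  have hsum := Finset.card_filter_add_card_filter_not (s := D)
    fun e => D.card ≤ 2 * (D.filter fun e' => d e' ≤ d e).card
  rcases bad.eq_empty_or_nonempty with h0 | h0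
  · rw [← hbad, h0, Finset.card_empty] at hsum
    omega
  · obtain ⟨e, he, hmax⟩ := Finset.exists_max_image bad d h0
    have hsub : bad ⊆ D.filter fun e' => d e' ≤ d e := fun x hx =>
      Finset.mem_filter.2 ⟨(Finset.mem_filter.1 hx).1, hmax x hx⟩
    have h1 := Finset.card_le_card hsub
    have h2 := (Finset.mem_filter.1 he).2
    rw [← hbad] at hsum
    omega

variable {V ε : Type} [Fintype V] [DecidableEq V] [DecidableEq ε] (m : ℕ) (ident : V → ℕ)
  (C : V → Finset ε)

/-- The vertices whose sets contain `e`. -/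
def holders (e : ε) : Finset V := Finset.univ.filter fun v => e ∈ C v

variable {m ident C}

open Classical in
/-- The outcomes in which `v` is the first holder of `e`, and of at least an eighth of its
elements. -/
def winning (m : ℕ) (ident : V → ℕ) (C : V → Finset ε) (v : V) (e : ε) : Finset (V → Fin m) :=
  Finset.univ.filter fun r => IsFirst ident (fun x => (r x : ℕ)) (holders C e) v ∧
    (C v).card ≤ 8 * ((C v).filter fun e' =>
      IsFirst ident (fun x => (r x : ℕ)) (holders C e') v).card

open Classical in
/-- If half of the elements of `C v` are at most as frequent as `e`, then `v` wins `e` with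
probability at least `1 / 8` divided by the frequency of `e`: given that `v` is the first holder
of `e`, it is the first holder of such an element with probability about `1 / 2`. -/
theorem le_card_winning {v : V} {e : ε} (he : e ∈ C v)
    (hm : 16 * Fintype.card V ^ 2 ≤ m)
    (hhalf : (C v).card ≤ 2 * ((C v).filter fun e' =>
      (holders C e').card ≤ (holders C e).card).card) :
    (m : ℝ) ^ Fintype.card V / 8 ≤ (holders C e).card * (winning m ident C v e).card := by
  set B := (C v).filter fun e' => (holders C e').card ≤ (holders C e).card with hB
  set d := (holders C e).card with hd
  have hvn : 0 < Fintype.card V := Fintype.card_pos_iff.2 ⟨v⟩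
  have hm0 : 0 < m := by
    have : 0 < 16 * Fintype.card V ^ 2 := by positivity
    omega
  have hm' : (0 : ℝ) < m := by exact_mod_cast hm0
  have hvA : v ∈ holders C e := by simp [holders, he]
  have hd0 : 0 < d := Finset.card_pos.2 ⟨v, hvA⟩
  have hcard : ∀ A : Finset V, (A.card : ℝ) ^ 2 / m ≤ 1 / 16 := by
    intro A
    rw [div_le_div_iff₀ hm' (by norm_num)]
    have h1 : A.card ^ 2 ≤ Fintype.card V ^ 2 := Nat.pow_le_pow_left (Finset.card_le_univ A) 2
    have : A.card ^ 2 * 16 ≤ 1 * m := by omega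
    exact_mod_cast this
  have hP : (0 : ℝ) < (m : ℝ) ^ Fintype.card V := by positivity
  have hBpos : 0 < B.card := by
    have : 0 < (C v).card := Finset.card_pos.2 ⟨e, he⟩
    omega
  -- `v` is the first holder of both `e` and `e'`
  have hq : ∀ e' ∈ B, (15 / 32 : ℝ) * (m : ℝ) ^ Fintype.card V ≤
      d * ((firstOutcomes m ident (holders C e) v).filter fun r =>
        IsFirst ident (fun x => (r x : ℕ)) (holders C e') v).card := by
    intro e' he'
    have h1 := le_card_mul_firstOutcomes (m := m) (ident := ident)
      (Finset.mem_union_left (holders C e') hvA) hm0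
    have h2 : ((holders C e ∪ holders C e').card : ℝ) ≤ 2 * d := by
      have := (Finset.mem_filter.1 he').2
      have h3 := Finset.card_union_le (holders C e) (holders C e')
      have : (holders C e ∪ holders C e').card ≤ 2 * d := by omega
      exact_mod_cast this
    have h3 : firstOutcomes m ident (holders C e ∪ holders C e') v ⊆
        (firstOutcomes m ident (holders C e) v).filter fun r =>
        IsFirst ident (fun x => (r x : ℕ)) (holders C e') v := by
      intro r hr
      simp only [firstOutcomes, Finset.mem_filter, Finset.mem_univ, true_and] at hr ⊢
      exact ⟨fun x hx => hr x (Finset.mem_union_left _ hx),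
        fun x hx => hr x (Finset.mem_union_right _ hx)⟩
    have h4 : ((firstOutcomes m ident (holders C e ∪ holders C e') v).card : ℝ) ≤
        ((firstOutcomes m ident (holders C e) v).filter fun r =>
        IsFirst ident (fun x => (r x : ℕ)) (holders C e') v).card := by
      exact_mod_cast Finset.card_le_card h3
    have h5 := hcard (holders C e ∪ holders C e')
    have h6 : (m : ℝ) ^ Fintype.card V * (15 / 16) ≤
        (2 * d) * ((firstOutcomes m ident (holders C e) v).filter fun r =>
        IsFirst ident (fun x => (r x : ℕ)) (holders C e') v).card := by
      refine le_trans ?_ (h1.trans ?_)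
      · gcongr; linarith
      · gcongr
    linarith
  -- double counting of the pairs of an outcome and an element of `B`
  have hcount : ∑ e' ∈ B, (((firstOutcomes m ident (holders C e) v).filter fun r =>
        IsFirst ident (fun x => (r x : ℕ)) (holders C e') v).card : ℝ) ≤
      B.card * (winning m ident C v e).card +
        B.card / 4 * (firstOutcomes m ident (holders C e) v).card := by
    have h1 : ∑ e' ∈ B, ((firstOutcomes m ident (holders C e) v).filter fun r =>
        IsFirst ident (fun x => (r x : ℕ)) (holders C e') v).card =
        ∑ r ∈ firstOutcomes m ident (holders C e) v, (B.filter fun e' =>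
          IsFirst ident (fun x => (r x : ℕ)) (holders C e') v).card := by
      simp only [Finset.card_filter]
      exact Finset.sum_comm
    have h2 : ∀ r ∈ firstOutcomes m ident (holders C e) v, ((B.filter fun e' =>
          IsFirst ident (fun x => (r x : ℕ)) (holders C e') v).card : ℝ) ≤
        (if r ∈ winning m ident C v e then (B.card : ℝ) else 0) + B.card / 4 := by
      intro r hr
      by_cases hw : r ∈ winning m ident C v e
      · rw [if_pos hw]
        have : ((B.filter fun e' =>
          IsFirst ident (fun x => (r x : ℕ)) (holders C e') v).card : ℝ) ≤ B.card := by
          exact_mod_cast Finset.card_filter_le _ _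
        have h0 : (0 : ℝ) ≤ B.card / 4 := by positivity
        linarith
      · rw [if_neg hw, zero_add]
        simp only [firstOutcomes, winning, Finset.mem_filter, Finset.mem_univ, true_and] at hr hw
        have h3 := not_le.1 (not_and.1 hw hr)
        have h4 : (B.filter fun e' =>
          IsFirst ident (fun x => (r x : ℕ)) (holders C e') v).card ≤ ((C v).filter fun e' =>
          IsFirst ident (fun x => (r x : ℕ)) (holders C e') v).card := by
          apply Finset.card_le_card
          exact Finset.filter_subset_filter _ (Finset.filter_subset _ _)
        have h5 : 4 * (B.filter fun e' =>
          IsFirst ident (fun x => (r x : ℕ)) (holders C e') v).card ≤ B.card := by omega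
        rw [le_div_iff₀ (by norm_num)]
        have h6 : (4 : ℝ) * ((B.filter fun e' =>
          IsFirst ident (fun x => (r x : ℕ)) (holders C e') v).card : ℝ) ≤ B.card := by
          exact_mod_cast h5
        linarith
    have h3 : (∑ e' ∈ B, (((firstOutcomes m ident (holders C e) v).filter fun r =>
        IsFirst ident (fun x => (r x : ℕ)) (holders C e') v).card : ℝ)) =
        ∑ r ∈ firstOutcomes m ident (holders C e) v, ((B.filter fun e' =>
          IsFirst ident (fun x => (r x : ℕ)) (holders C e') v).card : ℝ) := by
      exact_mod_cast h1
    rw [h3]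
    refine (Finset.sum_le_sum h2).trans ?_
    rw [Finset.sum_add_distrib, ← Finset.sum_filter, Finset.sum_const, Finset.sum_const,
      nsmul_eq_mul, nsmul_eq_mul, mul_comm, mul_comm ((firstOutcomes m ident _ v).card : ℝ)]
    gcongr
    intro r hr
    exact (Finset.mem_filter.1 hr).2
  have hlow : (B.card : ℝ) * ((15 / 32 : ℝ) * (m : ℝ) ^ Fintype.card V) ≤
      d * ∑ e' ∈ B, (((firstOutcomes m ident (holders C e) v).filter fun r =>
        IsFirst ident (fun x => (r x : ℕ)) (holders C e') v).card : ℝ) := by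
    rw [Finset.mul_sum, ← nsmul_eq_mul, ← Finset.sum_const]
    exact Finset.sum_le_sum hq
  have hup := card_mul_firstOutcomes_le (m := m) (ident := ident) hvA hm0
  have hup' : (d : ℝ) * (firstOutcomes m ident (holders C e) v).card ≤
      (m : ℝ) ^ Fintype.card V * (17 / 16) := by
    refine hup.trans ?_
    have := hcard (holders C e)
    gcongr
    linarith
  have hBr : (0 : ℝ) < B.card := by exact_mod_cast hBpos
  have hfin : (B.card : ℝ) * ((15 / 32 : ℝ) * (m : ℝ) ^ Fintype.card V) ≤
      B.card * (d * (winning m ident C v e).card + 17 / 64 * (m : ℝ) ^ Fintype.card V) := by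
    calc (B.card : ℝ) * ((15 / 32 : ℝ) * (m : ℝ) ^ Fintype.card V)
        ≤ d * (B.card * (winning m ident C v e).card +
        B.card / 4 * (firstOutcomes m ident (holders C e) v).card) := by
          refine hlow.trans ?_
          gcongr
      _ = B.card * (d * (winning m ident C v e).card +
          1 / 4 * (d * (firstOutcomes m ident (holders C e) v).card)) := by ring
      _ ≤ _ := by
          refine mul_le_mul_of_nonneg_left ?_ hBr.le
          linarith
  have := le_of_mul_le_mul_left hfin hBr
  linarith

open Classical in
/-- The elements won in a random order, counted with their frequencies, are on average at least
one sixteenth of all incidences. -/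
theorem le_sum_won (hm : 16 * Fintype.card V ^ 2 ≤ m) :
    (m : ℝ) ^ Fintype.card V / 16 * ∑ v, ((C v).card : ℝ) ≤
      ∑ r : V → Fin m, ∑ v, ∑ e ∈ C v,
        if r ∈ winning m ident C v e then ((holders C e).card : ℝ) else 0 := by
  have h1 : ∑ r : V → Fin m, ∑ v, ∑ e ∈ C v,
        (if r ∈ winning m ident C v e then ((holders C e).card : ℝ) else 0) =
      ∑ v, ∑ e ∈ C v, ((holders C e).card : ℝ) * (winning m ident C v e).card := by
    rw [Finset.sum_comm]
    refine Finset.sum_congr rfl fun v _ => ?_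
    rw [Finset.sum_comm]
    refine Finset.sum_congr rfl fun e _ => ?_
    rw [← Finset.sum_filter, Finset.sum_const, nsmul_eq_mul, Finset.filter_mem_eq_inter,
      Finset.univ_inter, mul_comm]
  rw [h1, Finset.mul_sum]
  refine Finset.sum_le_sum fun v _ => ?_
  have h2 := card_le_two_mul_card_frequent (C v) fun e => (holders C e).card
  set good := (C v).filter fun e => (C v).card ≤ 2 * ((C v).filter fun e' =>
    (holders C e').card ≤ (holders C e).card).card with hgood
  calc (m : ℝ) ^ Fintype.card V / 16 * ((C v).card : ℝ)
      ≤ (m : ℝ) ^ Fintype.card V / 16 * (2 * good.card) := by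
        gcongr
        exact_mod_cast h2
    _ = ∑ e ∈ good, (m : ℝ) ^ Fintype.card V / 8 := by
        rw [Finset.sum_const, nsmul_eq_mul]; ring
    _ ≤ ∑ e ∈ good, ((holders C e).card : ℝ) * (winning m ident C v e).card := by
        refine Finset.sum_le_sum fun e he => ?_
        rw [hgood, Finset.mem_filter] at he
        exact le_card_winning he.1 hm he.2
    _ ≤ _ := Finset.sum_le_sum_of_subset_of_nonneg (Finset.filter_subset _ _)
        fun e _ _ => by positivity

end Voting
end

/-! ### The global process -/

noncomputable section

/-- What a vertex announces in an iteration: its input, the uncovered edges in its closed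
neighborhood, and its random number. -/
structure Proposal where
  inp : LocalInput
  edges : Finset (Sym2 ℕ)
  coin : ℕ

namespace Proposal

variable (p : Proposal)

/-- The rounded density of the proposing vertex. -/
def level : ℤ := p.inp.level p.edges

/-- The leaves of the proposed star. -/
def star : Finset ℕ := p.inp.star p.edges p.level

/-- The uncovered edges that the proposed star 2-spans. -/
def span : Finset (Sym2 ℕ) := p.inp.spanned p.star p.edges

/-- The priority of the proposal: smaller keys win. -/
def key : ℕ ×ₗ ℕ := toLex (p.coin, p.inp.ident)

/-- The edge `e` supports the proposal `p` against those in `Q`: no vertex that could 2-span `e`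
has a higher level, and among the proposals of this level that 2-span `e`, the key of `p` is the
smallest. -/
def Supports (Q : Set Proposal) (e : Sym2 ℕ) : Prop :=
  ∀ q ∈ Q, e ∈ q.edges → q.level < p.level ∨ q.level = p.level ∧ (e ∈ q.span → p.key ≤ q.key)

open Classical in
/-- The edges that the proposed star 2-spans and that support it. -/
def supporters (Q : Set Proposal) : Finset (Sym2 ℕ) := p.span.filter fun e => p.Supports Q e

/-- The proposed star is taken if it is supported by an eighth of the edges that it 2-spans. -/
def Joins (Q : Set Proposal) : Prop := p.span.card ≤ 8 * (p.supporters Q).card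

end Proposal

/-- The state of the whole network between two iterations: the leaves of the stars taken so far,
and the edges that these stars do not 2-span. -/
structure GlobalState (V : Type) where
  chosen : V → Finset ℕ
  uncovered : Finset (Sym2 ℕ)

namespace LocalInput

/-- The neighbors along edges of weight `0`. -/
def zeroLeaves (I : LocalInput) : Finset ℕ := (I.incident.filter fun p => p.2 = 0).image Prod.fst

end LocalInput

namespace WeightedNetwork

variable {V : Type} [Fintype V] (net : WeightedNetwork V) (N : ℕ)

open Classical in
/-- The edges of the network, as pairs of identifiers. -/
def idEdges : Finset (Sym2 ℕ) := net.graph.edgeFinset.image (Sym2.map net.ident)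

open Classical in
/-- The edges in `U` that no star with center `v` and leaves `A v` 2-spans. -/
def notSpanned (A : V → Finset ℕ) (U : Finset (Sym2 ℕ)) : Finset (Sym2 ℕ) :=
  U.filter fun e => ∀ v, e ∉ (insert (net.ident v) (A v)).sym2

/-- At the start all edges of weight `0` are taken. -/
def startState : GlobalState V where
  chosen v := (net.localInput N v).zeroLeaves
  uncovered := net.notSpanned (fun v => (net.localInput N v).zeroLeaves) net.idEdges

/-- The proposal of `v` if `U` is the set of uncovered edges and `r` gives the random numbers. -/
def proposal (U : Finset (Sym2 ℕ)) (r : V → ℕ) (v : V) : Proposal where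
  inp := net.localInput N v
  edges := (net.localInput N v).near U
  coin := r v

/-- The star of `v` is taken in the present iteration. -/
def Joins (U : Finset (Sym2 ℕ)) (r : V → ℕ) (v : V) : Prop :=
  ((net.localInput N v).near U).Nonempty ∧
    (net.proposal N U r v).Joins (Set.range (net.proposal N U r))

open Classical in
/-- The leaves of the stars taken after one more iteration. -/
def nextChosen (s : GlobalState V) (r : V → ℕ) (v : V) : Finset ℕ :=
  if net.Joins N s.uncovered r v then s.chosen v ∪ (net.proposal N s.uncovered r v).star
  else s.chosen v

/-- One iteration, with the random numbers `r`. -/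
def nextState (s : GlobalState V) (r : V → ℕ) : GlobalState V where
  chosen := net.nextChosen N s r
  uncovered := net.notSpanned (net.nextChosen N s r) s.uncovered

/-- The state after `i` iterations, with the random numbers `ρ 0`, `ρ 1`, … -/
def run (ρ : ℕ → V → ℕ) : ℕ → GlobalState V
  | 0 => net.startState N
  | i + 1 => net.nextState N (run ρ i) (ρ i)

variable {net N}

theorem ident_localInput (v : V) : (net.localInput N v).ident = net.ident v := rfl

theorem mem_incident {v : V} {p : ℕ × ℝ} : p ∈ (net.localInput N v).incident ↔
    ∃ u, net.graph.Adj v u ∧ p = (net.ident u, net.weight s(v, u)) := by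
  simp [localInput, eq_comm]

theorem mem_neighborIdents {v : V} {a : ℕ} :
    a ∈ net.neighborIdents v ↔ ∃ u, net.graph.Adj v u ∧ net.ident u = a := by
  simp [neighborIdents]

theorem nbrs_localInput (v : V) : (net.localInput N v).nbrs = net.neighborIdents v := by
  ext a
  simp only [LocalInput.nbrs, Finset.mem_image, mem_incident, mem_neighborIdents]
  constructor
  · rintro ⟨p, ⟨u, hu, rfl⟩, rfl⟩
    exact ⟨u, hu, rfl⟩
  · rintro ⟨u, hu, rfl⟩
    exact ⟨_, ⟨u, hu, rfl⟩, rfl⟩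

theorem mem_idEdges {e : Sym2 ℕ} :
    e ∈ net.idEdges ↔ ∃ u v, net.graph.Adj u v ∧ e = s(net.ident u, net.ident v) := by
  classical
  simp only [idEdges, Finset.mem_image, SimpleGraph.mem_edgeFinset]
  constructor
  · rintro ⟨e, he, rfl⟩
    induction e with | _ u v => exact ⟨u, v, he, rfl⟩
  · rintro ⟨u, v, h, rfl⟩
    exact ⟨s(u, v), h, rfl⟩

open Classical in
theorem starWeight_localInput (v : V) (S : Finset ℕ) : (net.localInput N v).starWeight S =
    ∑ u ∈ (net.graph.neighborFinset v).filter (fun u => net.ident u ∈ S), net.weight s(v, u) := by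
  have : (net.localInput N v).incident.filter (fun p => p.1 ∈ S) =
      ((net.graph.neighborFinset v).filter (fun u => net.ident u ∈ S)).image
        fun u => (net.ident u, net.weight s(v, u)) := by
    ext p
    simp only [Finset.mem_filter, mem_incident, Finset.mem_image, SimpleGraph.mem_neighborFinset]
    constructor
    · rintro ⟨⟨u, hu, rfl⟩, h⟩
      exact ⟨u, ⟨hu, h⟩, rfl⟩
    · rintro ⟨u, ⟨hu, h⟩, rfl⟩
      exact ⟨⟨u, hu, rfl⟩, h⟩
  rw [LocalInput.starWeight, this, Finset.sum_image]
  intro a _ b _ h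
  exact net.ident_injective (Prod.ext_iff.1 h).1

theorem incident_nonneg {v : V} {p : ℕ × ℝ} (hp : p ∈ (net.localInput N v).incident) :
    0 ≤ p.2 := by
  obtain ⟨u, hu, rfl⟩ := mem_incident.1 hp
  exact net.weight_nonneg _ hu

theorem notSpanned_subset {A : V → Finset ℕ} {U : Finset (Sym2 ℕ)} : net.notSpanned A U ⊆ U :=
  Finset.filter_subset _ _

theorem mem_notSpanned {A : V → Finset ℕ} {U : Finset (Sym2 ℕ)} {e : Sym2 ℕ} :
    e ∈ net.notSpanned A U ↔ e ∈ U ∧ ∀ v, e ∉ (insert (net.ident v) (A v)).sym2 :=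
  Finset.mem_filter

theorem zeroLeaves_subset (v : V) : (net.localInput N v).zeroLeaves ⊆ net.neighborIdents v := by
  rw [← nbrs_localInput (N := N)]
  exact Finset.image_subset_image (Finset.filter_subset _ _)

/-- A star that 2-spans an edge not 2-spanned by edges of weight `0` has an edge of positive
weight. -/
theorem exists_positiveWeight_le {U : Finset (Sym2 ℕ)} (hU : U ⊆ (net.startState N).uncovered)
    {v : V} {S : Finset ℕ} (hS : S ⊆ (net.localInput N v).nbrs)
    (hne : ((net.localInput N v).spanned S U).Nonempty) :
    ∃ x ∈ net.positiveWeights, x ≤ (net.localInput N v).starWeight S := by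
  by_contra! hcon
  obtain ⟨e, he⟩ := hne
  rw [LocalInput.mem_spanned] at he
  refine (mem_notSpanned.1 (hU he.1)).2 v (Finset.mem_sym2_iff.2 fun x hx => ?_)
  refine Finset.insert_subset_insert _ ?_ (he.2 x hx)
  intro a ha
  obtain ⟨p, hp, rfl⟩ := Finset.mem_image.1 (hS ha)
  refine Finset.mem_image_of_mem _ (Finset.mem_filter.2 ⟨hp, ?_⟩)
  by_contra h0
  have hpos := lt_of_le_of_ne (incident_nonneg hp) (Ne.symm h0)
  refine absurd (hcon p.2 ⟨hpos, ?_⟩) (not_lt.2 ?_)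
  · obtain ⟨u, hu, rfl⟩ := mem_incident.1 hp
    exact ⟨_, hu, rfl⟩
  · exact Finset.single_le_sum (f := fun p : ℕ × ℝ => p.2)
      (fun q hq => incident_nonneg (Finset.mem_filter.1 hq).1) (Finset.mem_filter.2 ⟨hp, ha⟩)

theorem uncovered_startState_subset : (net.startState N).uncovered ⊆ net.idEdges :=
  notSpanned_subset

theorem regular {U : Finset (Sym2 ℕ)} (hU : U ⊆ (net.startState N).uncovered) (v : V) :
    (net.localInput N v).Regular U where
  nonneg _ hp := incident_nonneg hp
  spanned_empty := by
    rw [Finset.eq_empty_iff_forall_notMem]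
    intro e he
    rw [LocalInput.mem_spanned] at he
    obtain ⟨a, b, hab, rfl⟩ := mem_idEdges.1 (uncovered_startState_subset (hU he.1))
    have h1 := he.2 (net.ident a) (by simp)
    have h2 := he.2 (net.ident b) (by simp)
    simp only [insert_empty_eq, Finset.mem_singleton] at h1 h2
    exact hab.ne (net.ident_injective (h1.trans h2.symm))
  pos S hS hne := by
    obtain ⟨x, hx, hle⟩ := exists_positiveWeight_le hU hS hne
    exact hx.1.trans_le hle

theorem regular_near {U : Finset (Sym2 ℕ)} (hU : U ⊆ (net.startState N).uncovered) (v : V) :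
    (net.localInput N v).Regular ((net.localInput N v).near U) :=
  (regular hU v).mono LocalInput.near_subset

/-- An edge lies in the closed neighborhood of its ends. -/
theorem mem_near_of_mem {U : Finset (Sym2 ℕ)} (hU : U ⊆ net.idEdges) {e : Sym2 ℕ} (he : e ∈ U)
    {v : V} (hv : net.ident v ∈ e) : e ∈ (net.localInput N v).near U := by
  rw [LocalInput.near, LocalInput.mem_spanned, nbrs_localInput]
  refine ⟨he, ?_⟩
  obtain ⟨a, b, hab, rfl⟩ := mem_idEdges.1 (hU he)
  rw [Sym2.mem_iff] at hv
  intro x hx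
  rw [Sym2.mem_iff] at hx
  rw [Finset.mem_insert, mem_neighborIdents, ident_localInput]
  rcases hv with hv | hv <;> have hv := net.ident_injective hv <;> subst hv <;>
    rcases hx with rfl | rfl
  · exact Or.inl rfl
  · exact Or.inr ⟨b, hab, rfl⟩
  · exact Or.inr ⟨a, hab.symm, rfl⟩
  · exact Or.inl rfl

theorem near_nonempty_of_nonempty {U : Finset (Sym2 ℕ)} (hU : U ⊆ net.idEdges)
    (hne : U.Nonempty) : ∃ v, ((net.localInput N v).near U).Nonempty := by
  obtain ⟨e, he⟩ := hne
  obtain ⟨a, b, hab, rfl⟩ := mem_idEdges.1 (hU he)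
  exact ⟨a, _, mem_near_of_mem hU he (by simp)⟩

variable {U : Finset (Sym2 ℕ)} {r : V → ℕ} {s : GlobalState V}

theorem span_proposal (v : V) : (net.proposal N U r v).span =
    (net.localInput N v).spanned (net.proposal N U r v).star U :=
  LocalInput.spanned_near LocalInput.star_subset

theorem level_proposal (v : V) : (net.proposal N U r v).level =
    (net.localInput N v).level ((net.localInput N v).near U) := rfl

theorem span_subset (v : V) : (net.proposal N U r v).span ⊆ (net.localInput N v).near U :=
  LocalInput.spanned_subset

theorem mem_supporters {v : V} {Q : Set Proposal} {e : Sym2 ℕ} :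
    e ∈ (net.proposal N U r v).supporters Q ↔ e ∈ (net.proposal N U r v).span ∧
      (net.proposal N U r v).Supports Q e := by
  classical
  rw [Proposal.supporters, Finset.mem_filter]

/-- An edge supports at most one proposal. -/
theorem supporters_disjoint {v v' : V} (h : v ≠ v') :
    Disjoint ((net.proposal N U r v).supporters (Set.range (net.proposal N U r)))
      ((net.proposal N U r v').supporters (Set.range (net.proposal N U r))) := by
  rw [Finset.disjoint_left]
  intro e he he'
  rw [mem_supporters] at he he'
  have h1 := he.2 _ ⟨v', rfl⟩ (span_subset _ he'.1)
  have h2 := he'.2 _ ⟨v, rfl⟩ (span_subset _ he.1)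
  rcases h1 with h1 | ⟨h1, h3⟩ <;> rcases h2 with h2 | ⟨h2, h4⟩
  · omega
  · omega
  · omega
  · have := le_antisymm (h3 he'.1) (h4 he.1)
    exact h (net.ident_injective (Prod.ext_iff.1 (toLex.injective this)).2)

/-- The edges 2-spanned by a taken star are covered afterwards. -/
theorem span_disjoint_uncovered {v : V} (h : net.Joins N s.uncovered r v) :
    Disjoint (net.proposal N s.uncovered r v).span (net.nextState N s r).uncovered := by
  rw [Finset.disjoint_left]
  intro e he he'
  refine (mem_notSpanned.1 he').2 v (Finset.mem_sym2_iff.2 fun x hx => ?_)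
  rw [span_proposal, LocalInput.mem_spanned] at he
  rw [nextChosen, if_pos h]
  exact Finset.insert_subset_insert _ Finset.subset_union_right (he.2 x hx)

theorem uncovered_nextState_subset : (net.nextState N s r).uncovered ⊆ s.uncovered :=
  notSpanned_subset

theorem chosen_subset_nextState (v : V) : s.chosen v ⊆ (net.nextState N s r).chosen v := by
  simp only [nextState, nextChosen]
  split_ifs
  · exact Finset.subset_union_left
  · exact subset_rfl

/-- At the highest level, an edge supports the first of the vertices proposing to 2-span it. -/
theorem supports_of_isFirst {ℓ : ℤ} {A : Finset V} {v : V} {e : Sym2 ℕ}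
    (htop : ∀ x, ((net.localInput N x).near U).Nonempty → (net.proposal N U r x).level ≤ ℓ)
    (hv : (net.proposal N U r v).level = ℓ)
    (hA : ∀ x, (net.proposal N U r x).level = ℓ → e ∈ (net.proposal N U r x).span → x ∈ A)
    (hf : IsFirst net.ident r A v) :
    (net.proposal N U r v).Supports (Set.range (net.proposal N U r)) e := by
  rintro _ ⟨x, rfl⟩ hx
  rw [hv]
  rcases lt_or_eq_of_le (htop x ⟨e, hx⟩) with h | h
  · exact Or.inl h
  · exact Or.inr ⟨h, fun h' => hf x (hA x h h')⟩

open Classical in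
theorem exists_top (hU : U ⊆ net.idEdges) (hne : U.Nonempty) :
    ∃ v, ((net.localInput N v).near U).Nonempty ∧
      ∀ x, ((net.localInput N x).near U).Nonempty →
        (net.localInput N x).level ((net.localInput N x).near U) ≤
          (net.localInput N v).level ((net.localInput N v).near U) := by
  obtain ⟨v₀, hv₀⟩ := near_nonempty_of_nonempty (N := N) hU hne
  obtain ⟨v, hv, hmax⟩ := Finset.exists_max_image
    (Finset.univ.filter fun v => ((net.localInput N v).near U).Nonempty)
    (fun v => (net.localInput N v).level ((net.localInput N v).near U)) ⟨v₀, by simpa using hv₀⟩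
  exact ⟨v, by simpa using hv, fun x hx => hmax x (by simpa using hx)⟩

theorem near_near (v : V) :
    (net.localInput N v).near ((net.localInput N v).near U) = (net.localInput N v).near U :=
  LocalInput.spanned_near subset_rfl

/-- Whatever the random numbers are, each iteration covers an edge: the first vertex of the
highest level gets all the support it asks for. -/
theorem card_uncovered_lt (hs : s.uncovered ⊆ (net.startState N).uncovered)
    (hne : s.uncovered.Nonempty) :
    (net.nextState N s r).uncovered.card < s.uncovered.card := by
  classical
  obtain ⟨v₀, hv₀, htop⟩ := exists_top (N := N) (hs.trans uncovered_startState_subset) hne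
  obtain ⟨v, hv, hfirst⟩ := exists_isFirst (ident := net.ident) r
    (A := Finset.univ.filter fun x => ((net.localInput N x).near s.uncovered).Nonempty ∧
      (net.proposal N s.uncovered r x).level = (net.proposal N s.uncovered r v₀).level)
    ⟨v₀, by simpa using hv₀⟩
  rw [Finset.mem_filter] at hv
  have hJ : net.Joins N s.uncovered r v := by
    refine ⟨hv.2.1, ?_⟩
    have : (net.proposal N s.uncovered r v).supporters
        (Set.range (net.proposal N s.uncovered r)) = (net.proposal N s.uncovered r v).span := by
      rw [Proposal.supporters, Finset.filter_true_of_mem]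
      intro e he
      refine supports_of_isFirst htop hv.2.2 (fun x hx hxe => ?_) hfirst
      exact Finset.mem_filter.2 ⟨Finset.mem_univ _, ⟨e, span_subset _ hxe⟩, hx⟩
    rw [Proposal.Joins, this]
    omega
  obtain ⟨e, he⟩ := (regular_near hs v).spanned_star_nonempty (by rw [near_near]; exact hv.2.1)
  refine Finset.card_lt_card ⟨uncovered_nextState_subset, fun hsub => ?_⟩
  have heU : e ∈ s.uncovered := LocalInput.near_subset (LocalInput.spanned_subset he)
  exact Finset.disjoint_left.1 (span_disjoint_uncovered hJ) he (hsub heU)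

theorem uncovered_run_subset (ρ : ℕ → V → ℕ) (i : ℕ) :
    (net.run N ρ i).uncovered ⊆ (net.startState N).uncovered := by
  induction i with
  | zero => exact subset_rfl
  | succ i ih => exact uncovered_nextState_subset.trans ih

theorem uncovered_run_antitone (ρ : ℕ → V → ℕ) :
    Antitone fun i => (net.run N ρ i).uncovered :=
  antitone_nat_of_succ_le fun _ => uncovered_nextState_subset

theorem exists_uncovered_run_eq_empty (ρ : ℕ → V → ℕ) :
    ∃ i, (net.run N ρ i).uncovered = ∅ := by
  have h : ∀ i, (net.run N ρ i).uncovered = ∅ ∨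
      (net.run N ρ i).uncovered.card + i ≤ (net.startState N).uncovered.card := by
    intro i
    induction i with
    | zero => exact Or.inr le_rfl
    | succ i ih =>
      rcases (net.run N ρ i).uncovered.eq_empty_or_nonempty with h0 | h0
      · exact Or.inl (Finset.subset_empty.1 (h0 ▸ uncovered_run_antitone ρ (Nat.le_succ i)))
      · have := card_uncovered_lt (r := ρ i) (uncovered_run_subset ρ i) h0
        change (net.run N ρ (i + 1)).uncovered.card < _ at this
        rcases ih with ih | ih
        · exact absurd ih h0.ne_empty
        · right; omega
  refine ⟨(net.startState N).uncovered.card + 1, (h _).resolve_right (by omega)⟩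

theorem chosen_run_subset (ρ : ℕ → V → ℕ) (i : ℕ) (v : V) :
    (net.run N ρ i).chosen v ⊆ net.neighborIdents v := by
  induction i with
  | zero => exact zeroLeaves_subset v
  | succ i ih =>
    simp only [run, nextState, nextChosen]
    split_ifs
    · refine Finset.union_subset ih ?_
      rw [← nbrs_localInput (N := N)]
      exact LocalInput.star_subset
    · exact ih

theorem exists_of_notMem_uncovered_run (ρ : ℕ → V → ℕ) (i : ℕ) {e : Sym2 ℕ}
    (he : e ∈ net.idEdges) (he' : e ∉ (net.run N ρ i).uncovered) :
    ∃ v, e ∈ (insert (net.ident v) ((net.run N ρ i).chosen v)).sym2 := by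
  induction i with
  | zero =>
    by_contra! h
    exact he' (mem_notSpanned.2 ⟨he, h⟩)
  | succ i ih =>
    by_cases h : e ∈ (net.run N ρ i).uncovered
    · by_contra! h'
      exact he' (mem_notSpanned.2 ⟨h, h'⟩)
    · obtain ⟨v, hv⟩ := ih h
      exact ⟨v, Finset.sym2_mono (Finset.insert_subset_insert _ (chosen_subset_nextState v)) hv⟩

end WeightedNetwork
end

/-! ### The approximation ratio -/

noncomputable section

theorem sub_div_le_harmonic_sub {a b : ℕ} (h : a ≤ b) :
    ((b : ℝ) - a) / b ≤ (harmonic b : ℝ) - harmonic a := by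
  induction b, h using Nat.le_induction with
  | base => simp
  | succ b hab ih =>
    rw [harmonic_succ]
    push_cast
    have hb : (0 : ℝ) ≤ b := Nat.cast_nonneg b
    have h1 : ((b : ℝ) + 1 - a) / (b + 1) ≤ ((b : ℝ) - a) / b + ((b : ℝ) + 1)⁻¹ := by
      rcases Nat.eq_zero_or_pos b with h0 | h0
      · subst h0
        have : a = 0 := by omega
        simp [this]
      · have hb' : (0 : ℝ) < b := by exact_mod_cast h0
        have hab' : (a : ℝ) ≤ b := by exact_mod_cast hab
        have h2 : ((b : ℝ) - a) / (b + 1) ≤ ((b : ℝ) - a) / b :=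
          div_le_div_of_nonneg_left (by linarith) hb' (by linarith)
        have h3 : ((b : ℝ) + 1 - a) / (b + 1) = ((b : ℝ) - a) / (b + 1) + ((b : ℝ) + 1)⁻¹ := by
          field_simp
          ring
        linarith
    linarith

namespace LocalInput

theorem starWeight_union_le {I : LocalInput} (h : ∀ p ∈ I.incident, 0 ≤ p.2) (S T : Finset ℕ) :
    I.starWeight (S ∪ T) ≤ I.starWeight S + I.starWeight T := by
  have := starWeight_union_add_inter (I := I) S T
  have : 0 ≤ I.starWeight (S ∩ T) :=
    Finset.sum_nonneg fun p hp => h p (Finset.mem_filter.1 hp).1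
  linarith

end LocalInput

namespace WeightedNetwork

variable {V : Type} [Fintype V] {net : WeightedNetwork V} {N : ℕ}
  {U : Finset (Sym2 ℕ)} {r : V → ℕ} {s : GlobalState V}

/-- The supporters of a taken star can pay for it, each of them `8` times the weight per spanned
edge that the level guarantees. -/
theorem Joins.weight_star_le (hs : U ⊆ (net.startState N).uncovered) {v : V}
    (hJ : net.Joins N U r v) :
    (net.localInput N v).starWeight (net.proposal N U r v).star ≤
      ∑ _e ∈ (net.proposal N U r v).supporters (Set.range (net.proposal N U r)),
        8 / 2 ^ (net.proposal N U r v).level := by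
  have h1 := (regular_near hs v).weight_star_le
    (j := (net.proposal N U r v).level)
  have h2 : ((net.proposal N U r v).span.card : ℝ) ≤
      8 * ((net.proposal N U r v).supporters (Set.range (net.proposal N U r))).card := by
    exact_mod_cast hJ.2
  have h3 : (0 : ℝ) < 2 ^ (net.proposal N U r v).level := by positivity
  rw [Finset.sum_const, nsmul_eq_mul, mul_div_assoc', le_div_iff₀ h3]
  refine le_trans (le_of_eq (mul_comm _ _)) (h1.trans (h2.trans (le_of_eq (mul_comm _ _))))

open Classical in
/-- The weight of the stars taken in one iteration, charged to stars `L x` that 2-span all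
uncovered edges: an edge that supports a taken star and is 2-spanned by `L x` pays for that star
at most a constant times what it would pay if `L x` were shared evenly by the uncovered edges
that it 2-spans. -/
theorem sum_starWeight_nextState_le (hs : s.uncovered ⊆ (net.startState N).uncovered)
    {L : V → Finset ℕ} (hL : ∀ x, L x ⊆ (net.localInput N x).nbrs)
    (hcov : ∀ e ∈ s.uncovered, ∃ x, e ∈ (net.localInput N x).spanned (L x) s.uncovered) :
    ∑ v, (net.localInput N v).starWeight ((net.nextState N s r).chosen v) ≤
      ∑ v, (net.localInput N v).starWeight (s.chosen v) +
      ∑ x, 16 * (net.localInput N x).starWeight (L x) *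
        ((harmonic ((net.localInput N x).spanned (L x) s.uncovered).card : ℝ) -
          harmonic ((net.localInput N x).spanned (L x)
            (net.nextState N s r).uncovered).card) := by
  set U := s.uncovered with hU
  set U' := (net.nextState N s r).uncovered with hU'
  set J := Finset.univ.filter fun v => net.Joins N U r v with hJ
  set F : V → Finset (Sym2 ℕ) := fun x => (net.localInput N x).spanned (L x) U with hF
  have hw0 : ∀ x S, 0 ≤ (net.localInput N x).starWeight S := fun x S =>
    (regular hs x).starWeight_nonneg S
  set g : Sym2 ℕ → ℝ := fun e => ∑ x,
    if e ∈ F x then 16 * (net.localInput N x).starWeight (L x) / (F x).card else 0 with hg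
  have hg0 : ∀ x e, 0 ≤
      if e ∈ F x then 16 * (net.localInput N x).starWeight (L x) / (F x).card else 0 := by
    intro x e
    have := hw0 x (L x)
    split_ifs <;> positivity
  have h1 : ∑ v, (net.localInput N v).starWeight ((net.nextState N s r).chosen v) ≤
      ∑ v, (net.localInput N v).starWeight (s.chosen v) +
      ∑ v ∈ J, (net.localInput N v).starWeight (net.proposal N U r v).star := by
    rw [hJ, Finset.sum_filter, ← Finset.sum_add_distrib]
    refine Finset.sum_le_sum fun v _ => ?_
    simp only [nextState, nextChosen]
    split_ifs
    · exact LocalInput.starWeight_union_le (fun p hp => incident_nonneg hp) _ _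
    · simp
  have h2 : ∀ v ∈ J, (net.localInput N v).starWeight (net.proposal N U r v).star ≤
      ∑ e ∈ (net.proposal N U r v).supporters (Set.range (net.proposal N U r)), g e := by
    intro v hv
    refine (Joins.weight_star_le hs (Finset.mem_filter.1 hv).2).trans
      (Finset.sum_le_sum fun e he => ?_)
    rw [mem_supporters] at he
    have heU : e ∈ U := LocalInput.near_subset (span_subset _ he.1)
    obtain ⟨x, hx⟩ := hcov e heU
    refine le_trans ?_ (Finset.single_le_sum (fun x _ => hg0 x e) (Finset.mem_univ x))
    rw [if_pos (show e ∈ F x from hx)]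
    have hFx : (0 : ℝ) < (F x).card := by exact_mod_cast Finset.card_pos.2 ⟨e, hx⟩
    have hnear : e ∈ (net.localInput N x).near U :=
      LocalInput.spanned_mono (hL x) subset_rfl hx
    have hlev : (net.proposal N U r x).level ≤ (net.proposal N U r v).level := by
      rcases he.2 _ ⟨x, rfl⟩ hnear with h | h
      · exact h.le
      · exact h.1.le
    have hF' : F x = (net.localInput N x).spanned (L x) ((net.localInput N x).near U) :=
      (LocalInput.spanned_near (hL x)).symm
    have hle := (regular_near hs x).card_spanned_le (hL x)
    rw [← hF', ← level_proposal (r := r)] at hle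
    have hpow : (2 : ℝ) ^ ((net.proposal N U r x).level + 1) ≤
        2 * 2 ^ (net.proposal N U r v).level := by
      rw [mul_comm, ← zpow_add_one₀ (by norm_num)]
      exact zpow_le_zpow_right₀ (by norm_num) (by omega)
    have h3 : (0 : ℝ) < 2 ^ (net.proposal N U r v).level := by positivity
    rw [div_le_div_iff₀ h3 hFx]
    have := mul_le_mul_of_nonneg_right hpow (hw0 x (L x))
    nlinarith
  have h3 : ∑ v ∈ J, (net.localInput N v).starWeight (net.proposal N U r v).star ≤
      ∑ e ∈ U \ U', g e := by
    refine (Finset.sum_le_sum h2).trans ?_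
    rw [← Finset.sum_biUnion fun v _ v' _ h => supporters_disjoint h]
    refine Finset.sum_le_sum_of_subset_of_nonneg ?_
      fun e _ _ => Finset.sum_nonneg fun x _ => hg0 x e
    intro e he
    obtain ⟨v, hv, he⟩ := Finset.mem_biUnion.1 he
    rw [mem_supporters] at he
    exact Finset.mem_sdiff.2 ⟨LocalInput.near_subset (span_subset _ he.1),
      Finset.disjoint_left.1 (span_disjoint_uncovered (Finset.mem_filter.1 hv).2) he.1⟩
  have h4 : ∑ e ∈ U \ U', g e ≤ ∑ x, 16 * (net.localInput N x).starWeight (L x) *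
        ((harmonic (F x).card : ℝ) -
          harmonic ((net.localInput N x).spanned (L x) U').card) := by
    rw [Finset.sum_comm]
    refine Finset.sum_le_sum fun x _ => ?_
    rw [← Finset.sum_filter, Finset.sum_const, nsmul_eq_mul]
    have hsub : (net.localInput N x).spanned (L x) U' ⊆ F x :=
      LocalInput.spanned_mono subset_rfl uncovered_nextState_subset
    have heq : (U \ U').filter (fun e => e ∈ F x) =
        F x \ (net.localInput N x).spanned (L x) U' := by
      ext e
      simp only [hF, Finset.mem_filter, Finset.mem_sdiff, LocalInput.mem_spanned]
      tauto
    rw [heq, Finset.card_sdiff_of_subset hsub, Nat.cast_sub (Finset.card_le_card hsub)]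
    have := sub_div_le_harmonic_sub (Finset.card_le_card hsub)
    have h16 : 0 ≤ 16 * (net.localInput N x).starWeight (L x) := by
      have := hw0 x (L x)
      positivity
    have := mul_le_mul_of_nonneg_left this h16
    refine le_trans (le_of_eq ?_) this
    ring
  linarith

theorem starWeight_zeroLeaves (v : V) :
    (net.localInput N v).starWeight (net.localInput N v).zeroLeaves = 0 := by
  refine Finset.sum_eq_zero fun p hp => ?_
  obtain ⟨hp, hp0⟩ := Finset.mem_filter.1 hp
  obtain ⟨q, hq, hqp⟩ := Finset.mem_image.1 hp0
  rw [Finset.mem_filter] at hq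
  obtain ⟨u, hu, rfl⟩ := mem_incident.1 hp
  obtain ⟨u', hu', rfl⟩ := mem_incident.1 hq.1
  have : u' = u := net.ident_injective hqp
  subst this
  exact hq.2

/-- Telescoping over the iterations; the edges of weight `0` taken at the start are free. -/
theorem sum_starWeight_run_le (ρ : ℕ → V → ℕ) (i : ℕ)
    {L : V → Finset ℕ} (hL : ∀ x, L x ⊆ (net.localInput N x).nbrs)
    (hcov : ∀ e ∈ net.idEdges, ∃ x, e ∈ (net.localInput N x).spanned (L x) net.idEdges) :
    ∑ v, (net.localInput N v).starWeight ((net.run N ρ i).chosen v) ≤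
      ∑ x, 16 * (net.localInput N x).starWeight (L x) *
        ((harmonic ((net.localInput N x).spanned (L x) (net.startState N).uncovered).card : ℝ) -
          harmonic ((net.localInput N x).spanned (L x) (net.run N ρ i).uncovered).card) := by
  induction i with
  | zero =>
    simp only [run]
    simp [startState, starWeight_zeroLeaves]
  | succ i ih =>
    have hsub := uncovered_run_subset (net := net) (N := N) ρ i
    refine (sum_starWeight_nextState_le hsub hL fun e he => ?_).trans
      ((add_le_add_left ih _).trans (le_of_eq ?_))
    · obtain ⟨x, hx⟩ := hcov e (uncovered_startState_subset (hsub he))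
      exact ⟨x, LocalInput.mem_spanned.2 ⟨he, (LocalInput.mem_spanned.1 hx).2⟩⟩
    · rw [← Finset.sum_add_distrib]
      refine Finset.sum_congr rfl fun x _ => ?_
      simp only [run]
      ring

open Classical in
/-- The leaves of the star with center `v` in the set of edges `H`. -/
def leavesOf (net : WeightedNetwork V) (H : Finset (Sym2 V)) (v : V) : Finset ℕ :=
  (Finset.univ.filter fun u => s(v, u) ∈ H).image net.ident

theorem mem_leavesOf {H : Finset (Sym2 V)} {v u : V} :
    net.ident u ∈ net.leavesOf H v ↔ s(v, u) ∈ H := by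
  classical
  simp [leavesOf, net.ident_injective.eq_iff]

theorem leavesOf_subset {H : Finset (Sym2 V)} (hH : (H : Set (Sym2 V)) ⊆ net.graph.edgeSet)
    (v : V) : net.leavesOf H v ⊆ (net.localInput N v).nbrs := by
  classical
  intro a ha
  rw [leavesOf] at ha
  obtain ⟨u, hu, rfl⟩ := Finset.mem_image.1 ha
  rw [nbrs_localInput, mem_neighborIdents]
  exact ⟨u, hH (Finset.mem_filter.1 hu).2, rfl⟩

/-- The stars of a 2-spanner 2-span all edges. -/
theorem exists_mem_spanned_leavesOf {H : Finset (Sym2 V)} (hH : IsKSpanner net.graph 2 H)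
    {e : Sym2 ℕ} (he : e ∈ net.idEdges) :
    ∃ x, e ∈ (net.localInput N x).spanned (net.leavesOf H x) net.idEdges := by
  obtain ⟨u, v, huv, rfl⟩ := mem_idEdges.1 he
  have key : ∀ x, (u = x ∨ s(x, u) ∈ H) → (v = x ∨ s(x, v) ∈ H) →
      s(net.ident u, net.ident v) ∈
        (net.localInput N x).spanned (net.leavesOf H x) net.idEdges := by
    intro x hu hv
    rw [LocalInput.mem_spanned]
    refine ⟨he, fun a ha => ?_⟩
    rw [Finset.mem_insert, ident_localInput]
    rw [Sym2.mem_iff] at ha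
    rcases ha with rfl | rfl
    · exact hu.imp (congrArg _) mem_leavesOf.2
    · exact hv.imp (congrArg _) mem_leavesOf.2
  obtain ⟨p, -, hp⟩ := hH.2 u v huv
  match p, hp with
  | .nil, _ => exact absurd rfl huv.ne
  | .cons h .nil, _ =>
    exact ⟨u, key u (Or.inl rfl)
      (Or.inr (by simpa using (SimpleGraph.fromEdgeSet_adj _).1 h |>.1))⟩
  | .cons (v := x) h (.cons h' .nil), _ =>
    refine ⟨x, key x (Or.inr ?_) (Or.inr ?_)⟩
    · rw [Sym2.eq_swap]; simpa using ((SimpleGraph.fromEdgeSet_adj _).1 h).1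
    · simpa using ((SimpleGraph.fromEdgeSet_adj _).1 h').1
  | .cons h (.cons h' (.cons h'' q)), hp => simp at hp

open Classical in
theorem starWeight_leavesOf {H : Finset (Sym2 V)} (hH : (H : Set (Sym2 V)) ⊆ net.graph.edgeSet)
    (v : V) : (net.localInput N v).starWeight (net.leavesOf H v) =
      ∑ e ∈ H with v ∈ e, net.weight e := by
  rw [starWeight_localInput]
  refine Finset.sum_bij (fun u _ => s(v, u)) ?_ ?_ ?_ ?_
  · intro u hu
    rw [Finset.mem_filter, mem_leavesOf] at hu
    simpa using hu.2
  · intro a _ b _ h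
    exact Sym2.congr_right.1 h
  · intro e he
    rw [Finset.mem_filter] at he
    obtain ⟨u, rfl⟩ := he.2
    exact ⟨u, Finset.mem_filter.2 ⟨by simpa using hH he.1, mem_leavesOf.2 he.1⟩, rfl⟩
  · intro u _; rfl

/-- Each edge lies in the stars of its two ends. -/
theorem sum_starWeight_leavesOf {H : Finset (Sym2 V)}
    (hH : (H : Set (Sym2 V)) ⊆ net.graph.edgeSet) :
    ∑ v, (net.localInput N v).starWeight (net.leavesOf H v) = 2 * net.cost H := by
  classical
  simp only [starWeight_leavesOf hH, Finset.sum_filter]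
  rw [Finset.sum_comm, cost, Finset.mul_sum]
  refine Finset.sum_congr rfl fun e he => ?_
  rw [← Finset.sum_filter, Finset.sum_const, nsmul_eq_mul]
  have hd := net.graph.not_isDiag_of_mem_edgeSet (hH he)
  have : (Finset.univ.filter fun v => v ∈ e).card = 2 := by
    rw [← Sym2.card_toFinset_of_not_isDiag e hd]
    congr 1
    ext; simp
  rw [this, Nat.cast_ofNat]

theorem card_neighborIdents_le (v : V) : (net.neighborIdents v).card ≤ net.maxDegree := by
  classical
  refine Finset.card_image_le.trans ?_
  rw [maxDegree, SimpleGraph.card_neighborFinset_eq_degree]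
  exact SimpleGraph.degree_le_maxDegree _ _

theorem card_spanned_le {S : Finset ℕ} {v : V} (hS : S ⊆ net.neighborIdents v) :
    ((net.localInput N v).spanned S U).card ≤ (net.maxDegree + 1) ^ 2 := by
  have h1 : (insert (net.ident v) S).card ≤ net.maxDegree + 1 :=
    (Finset.card_insert_le _ _).trans
      (Nat.add_le_add_right ((Finset.card_le_card hS).trans (card_neighborIdents_le v)) 1)
  refine (Finset.card_le_card Finset.inter_subset_right).trans ?_
  rw [Finset.card_sym2, Nat.choose_two_right, ident_localInput, Nat.add_sub_cancel]
  refine (Nat.div_le_of_le_mul ?_).trans (Nat.pow_le_pow_left h1 2)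
  nlinarith [Nat.le_mul_self (insert (net.ident v) S).card]

/-- The stars taken weigh at most `O(log Δ)` times as much as a 2-spanner. -/
theorem sum_starWeight_run_le_cost (ρ : ℕ → V → ℕ) (i : ℕ) {H : Finset (Sym2 V)}
    (hH : IsKSpanner net.graph 2 H) :
    ∑ v, (net.localInput N v).starWeight ((net.run N ρ i).chosen v) ≤
      32 * (1 + 2 * Real.log (net.maxDegree + 1)) * net.cost H := by
  refine (sum_starWeight_run_le ρ i (leavesOf_subset hH.1)
    fun e he => exists_mem_spanned_leavesOf hH he).trans ?_
  calc _ ≤ ∑ x, (net.localInput N x).starWeight (net.leavesOf H x) *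
        (16 * (1 + 2 * Real.log (net.maxDegree + 1))) := by
        refine Finset.sum_le_sum fun x _ => ?_
        have h1 : (harmonic ((net.localInput N x).spanned (net.leavesOf H x)
            (net.startState N).uncovered).card : ℝ) ≤
            1 + 2 * Real.log (net.maxDegree + 1) := by
          refine (harmonic_le_one_add_log _).trans ?_
          have hc := card_spanned_le (net := net) (N := N) (U := (net.startState N).uncovered)
            (v := x) (S := net.leavesOf H x)
            (by rw [← nbrs_localInput (N := N)]; exact leavesOf_subset hH.1 x)
          have hlog : (2 : ℝ) * Real.log (net.maxDegree + 1) =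
              Real.log (((net.maxDegree : ℝ) + 1) ^ 2) := by
            rw [Real.log_pow]; norm_num
          rcases Nat.eq_zero_or_pos ((net.localInput N x).spanned (net.leavesOf H x)
            (net.startState N).uncovered).card with h0 | h0
          · rw [h0, Nat.cast_zero, Real.log_zero]
            have : 0 ≤ Real.log ((net.maxDegree : ℝ) + 1) :=
              Real.log_nonneg (by linarith [Nat.cast_nonneg (α := ℝ) net.maxDegree])
            linarith
          · rw [hlog]
            have : (((net.localInput N x).spanned (net.leavesOf H x)
              (net.startState N).uncovered).card : ℝ) ≤ ((net.maxDegree : ℝ) + 1) ^ 2 := by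
              exact_mod_cast hc
            have := Real.log_le_log (by exact_mod_cast h0) this
            linarith
        have h2 : (0 : ℝ) ≤ harmonic ((net.localInput N x).spanned (net.leavesOf H x)
            (net.run N ρ i).uncovered).card := by
          have : 0 ≤ harmonic ((net.localInput N x).spanned (net.leavesOf H x)
            (net.run N ρ i).uncovered).card := Finset.sum_nonneg fun _ _ => by positivity
          exact_mod_cast this
        have h3 : 0 ≤ (net.localInput N x).starWeight (net.leavesOf H x) :=
          (regular subset_rfl x).starWeight_nonneg _
        have := mul_le_mul_of_nonneg_left (show _ ≤ _ from sub_le_self_iff _ |>.2 h2 |>.trans h1) h3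
        linarith
    _ = _ := by
        rw [← Finset.sum_mul, sum_starWeight_leavesOf hH.1]
        ring

end WeightedNetwork
end

/-! ### The expected decrease of the potential -/

noncomputable section

section RandomChain

open ProbabilityTheory

variable {V : Type} [Fintype V] {M : ℕ}

/-- The law of independent uniform random numbers. -/
def uniformCoins (V : Type) (M : ℕ) : Measure (ℕ × V → Fin (M + 1)) :=
  Measure.infinitePi fun _ : ℕ × V => (PMF.uniformOfFintype (Fin (M + 1))).toMeasure

instance : IsProbabilityMeasure (uniformCoins V M) := by
  unfold uniformCoins
  infer_instance

theorem measurableSet_row (t : ℕ) (r : V → Fin (M + 1)) :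
    MeasurableSet {ω : ℕ × V → Fin (M + 1) | ∀ v, ω (t, v) = r v} := by
  rw [Set.ofPred_forall]
  exact MeasurableSet.iInter fun v => measurableSet_eq_fun (measurable_pi_apply _) measurable_const

theorem uniformCoins_real_row (t : ℕ) (r : V → Fin (M + 1)) :
    (uniformCoins V M).real {ω | ∀ v, ω (t, v) = r v} =
      (((M + 1 : ℕ) : ℝ) ^ Fintype.card V)⁻¹ := by
  classical
  have : {ω : ℕ × V → Fin (M + 1) | ∀ v, ω (t, v) = r v} =
      Set.pi (({t} ×ˢ Finset.univ : Finset (ℕ × V)) : Set (ℕ × V)) fun p => {r p.2} := by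
    ext ω
    simp only [Set.mem_ofPred_eq, Set.mem_pi, Finset.coe_product, Finset.coe_singleton,
      Finset.coe_univ, Set.mem_prod, Set.mem_singleton_iff, Set.mem_univ, and_true, Prod.forall]
    exact ⟨fun h a v ha => ha ▸ h v, fun h v => h t v rfl⟩
  rw [this, measureReal_def, uniformCoins, Measure.infinitePi_pi _ fun _ _ => .singleton _]
  simp [ENNReal.toReal_add]

open Classical in
/-- A Markov chain `X` that is driven by the rows `τ 0 < τ 1 < …` of the random numbers. If a
non-negative function of the state decreases in expectation by the factor `q` in each step, then
its expectation decreases exponentially. -/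
theorem integral_chain_le {σ : Type} (f : σ → (V → ℕ) → σ) {τ : ℕ → ℕ} (hτ : StrictMono τ)
    (X : (ℕ × V → Fin (M + 1)) → ℕ → σ) (s₀ : σ) (h0 : ∀ ω, X ω 0 = s₀)
    (hstep : ∀ ω i, X ω (i + 1) = f (X ω i) fun v => (ω (τ i, v) : ℕ))
    (P : σ → ℝ) {q : ℝ} (hq : 0 ≤ q)
    (hP : ∀ ω i, ∑ r : V → Fin (M + 1), P (f (X ω i) fun v => (r v : ℕ)) ≤
      ((M + 1 : ℕ) : ℝ) ^ Fintype.card V * (q * P (X ω i))) (i : ℕ) :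
    Integrable (fun ω => P (X ω i)) (uniformCoins V M) ∧
      ∫ ω, P (X ω i) ∂(uniformCoins V M) ≤ q ^ i * P s₀ := by
  set μ := uniformCoins V M with hμ
  -- `X ω i` depends on the rows `τ j` with `j < i` only, hence is independent of the row `τ i`
  have hdep : ∀ i ω ω', (∀ j < i, ∀ v, ω (τ j, v) = ω' (τ j, v)) → X ω i = X ω' i := by
    intro i
    induction i with
    | zero => intro ω ω' _; rw [h0, h0]
    | succ i ih =>
      intro ω ω' h
      rw [hstep, hstep, ih ω ω' fun j hj => h j (by omega)]
      congr 1
      ext v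
      rw [h i (by omega) v]
  let S : ℕ → Finset (ℕ × V) := fun i => (Finset.range i).image τ ×ˢ Finset.univ
  let extend : ∀ i, (S i → Fin (M + 1)) → ℕ × V → Fin (M + 1) :=
    fun i x p => if h : p ∈ S i then x ⟨p, h⟩ else 0
  have hfac : ∀ i ω, X ω i = X (extend i fun p => ω p) i := by
    intro i ω
    apply hdep
    intro j hj v
    have : (τ j, v) ∈ S i := by
      simp only [S, Finset.mem_product, Finset.mem_image, Finset.mem_range, Finset.mem_univ,
        and_true]
      exact ⟨j, hj, rfl⟩
    simp only [extend, this, dif_pos]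
  have hmeas : ∀ i, Measurable fun (ω : ℕ × V → Fin (M + 1)) (p : S i) => ω p := fun i =>
    measurable_pi_lambda _ fun p => measurable_pi_apply _
  have hint : ∀ i (Q : σ → ℝ), Integrable (fun ω => Q (X ω i)) μ := by
    intro i Q
    have h1 : Integrable (fun x => Q (X (extend i x) i)) (μ.map fun ω (p : S i) => ω p) :=
      have : IsProbabilityMeasure (μ.map fun ω (p : S i) => ω p) :=
        Measure.isProbabilityMeasure_map (hmeas i).aemeasurable
      Integrable.of_finite
    have h2 := h1.comp_measurable (hmeas i)
    refine h2.congr (Filter.Eventually.of_forall fun ω => ?_)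
    change Q (X (extend i fun p => ω p) i) = Q (X ω i)
    rw [← hfac]
  refine ⟨hint i P, ?_⟩
  induction i with
  | zero => simp [h0]
  | succ i ih =>
    let T : Finset (ℕ × V) := {τ i} ×ˢ Finset.univ
    have hind : IndepFun (fun (ω : ℕ × V → Fin (M + 1)) (p : S i) => ω p)
        (fun (ω : ℕ × V → Fin (M + 1)) (p : T) => ω p) μ := by
      have h1 : iIndepFun (fun (p : ℕ × V) (ω : ℕ × V → Fin (M + 1)) => ω p) μ :=
        iIndepFun_infinitePi (X := fun _ x => x) fun _ => measurable_id
      refine h1.indepFun_finset (S i) T ?_ fun p => measurable_pi_apply p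
      rw [Finset.disjoint_left]
      intro p hp hp'
      simp only [S, T, Finset.mem_product, Finset.mem_image, Finset.mem_range, Finset.mem_univ,
        and_true, Finset.mem_singleton] at hp hp'
      obtain ⟨j, hj, hjp⟩ := hp
      have := hτ.injective (hjp.trans hp')
      omega
    -- condition on the value `r` of the row `τ i`
    have hprod : ∀ r : V → Fin (M + 1),
        ∫ ω, Set.indicator {ω | ∀ v, ω (τ i, v) = r v} (fun _ => (1 : ℝ)) ω *
          P (f (X ω i) fun v => (r v : ℕ)) ∂μ =
        (((M + 1 : ℕ) : ℝ) ^ Fintype.card V)⁻¹ *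
          ∫ ω, P (f (X ω i) fun v => (r v : ℕ)) ∂μ := by
      intro r
      have hset := measurableSet_row (τ i) r
      rw [← uniformCoins_real_row (τ i) r, ← integral_indicator_one hset]
      refine IndepFun.integral_fun_mul_eq_mul_integral ?_
        (measurable_const.indicator hset).aestronglyMeasurable
        (hint i fun s => P (f s fun v => (r v : ℕ))).aestronglyMeasurable
      have h1 := (hind.comp (φ := fun x => P (f (X (extend i x) i) fun v => (r v : ℕ)))
        (ψ := fun y => if ∀ v, y ⟨(τ i, v), by simp [T]⟩ = r v then (1 : ℝ) else 0)
        Measurable.of_discrete Measurable.of_discrete).symm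
      refine h1.congr (Filter.Eventually.of_forall fun ω => ?_)
        (Filter.Eventually.of_forall fun ω => ?_)
      · simp [Set.indicator_apply]
      · change P (f (X (extend i fun p => ω p) i) _) = P (f (X ω i) _)
        rw [← hfac i ω]
    have hsum : ∀ ω, P (X ω (i + 1)) = ∑ r : V → Fin (M + 1),
        Set.indicator {ω | ∀ v, ω (τ i, v) = r v} (fun _ => (1 : ℝ)) ω *
          P (f (X ω i) fun v => (r v : ℕ)) := by
      intro ω
      rw [hstep, Finset.sum_eq_single fun v => ω (τ i, v)]
      · simp
      · intro r _ hr
        rw [Set.indicator_of_notMem, zero_mul]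
        intro h
        exact hr (funext fun v => (h v).symm)
      · simp
    have hcard : (0 : ℝ) < ((M + 1 : ℕ) : ℝ) ^ Fintype.card V := by positivity
    calc ∫ ω, P (X ω (i + 1)) ∂μ
        = ∑ r : V → Fin (M + 1), (((M + 1 : ℕ) : ℝ) ^ Fintype.card V)⁻¹ *
            ∫ ω, P (f (X ω i) fun v => (r v : ℕ)) ∂μ := by
          simp_rw [hsum]
          rw [integral_finsetSum]
          · exact Finset.sum_congr rfl fun r _ => hprod r
          · intro r _
            have hset := measurableSet_row (τ i) r
            have h1 := (hint i fun s => P (f s fun v => (r v : ℕ))).indicator hset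
            refine h1.congr (Filter.Eventually.of_forall fun ω => ?_)
            simp [Set.indicator_apply]
      _ = (((M + 1 : ℕ) : ℝ) ^ Fintype.card V)⁻¹ *
            ∫ ω, ∑ r : V → Fin (M + 1), P (f (X ω i) fun v => (r v : ℕ)) ∂μ := by
          rw [integral_finsetSum _ fun r _ => hint i fun s => P (f s fun v => (r v : ℕ)),
            Finset.mul_sum]
      _ ≤ (((M + 1 : ℕ) : ℝ) ^ Fintype.card V)⁻¹ *
            ∫ ω, ((M + 1 : ℕ) : ℝ) ^ Fintype.card V * (q * P (X ω i)) ∂μ := by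
          gcongr
          · exact hint i fun s => ∑ r : V → Fin (M + 1), P (f s fun v => (r v : ℕ))
          · exact ((hint i P).const_mul q).const_mul _
          · exact fun ω => hP ω i
      _ = q * ∫ ω, P (X ω i) ∂μ := by
          rw [integral_const_mul, integral_const_mul, inv_mul_cancel_left₀ hcard.ne']
      _ ≤ q * (q ^ i * P s₀) := mul_le_mul_of_nonneg_left ih hq
      _ = _ := by ring

end RandomChain

namespace WeightedNetwork

variable {V : Type} [Fintype V] (net : WeightedNetwork V) (N : ℕ)

/-- The edges of `U` 2-spanned by the best star of `v` for the density `2 ^ j`. -/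
def block (j : ℤ) (U : Finset (Sym2 ℕ)) (v : V) : Finset (Sym2 ℕ) :=
  (net.localInput N v).spanned ((net.localInput N v).star ((net.localInput N v).near U) j)
    ((net.localInput N v).near U)

/-- The total number of edges spanned by the best stars for the density `2 ^ j`. -/
def incidences (j : ℤ) (U : Finset (Sym2 ℕ)) : ℕ := ∑ v, (net.block N j U v).card

/-- The potential function: the numbers of incidences for the levels `j₀, …, j₀ + K - 1`, with
weights that let each level dominate all lower ones. -/
def potential (j₀ : ℤ) (K B : ℕ) (U : Finset (Sym2 ℕ)) : ℕ :=
  ∑ k ∈ Finset.range K, B ^ k * net.incidences N (j₀ + k) U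

variable {net N} {U U' : Finset (Sym2 ℕ)} {r : V → ℕ} {s : GlobalState V} {j : ℤ}

theorem block_mono (h : U' ⊆ U) (v : V) : net.block N j U' v ⊆ net.block N j U v :=
  LocalInput.spanned_mono (LocalInput.star_mono (LocalInput.near_mono h)) (LocalInput.near_mono h)

theorem incidences_mono (h : U' ⊆ U) : net.incidences N j U' ≤ net.incidences N j U :=
  Finset.sum_le_sum fun v _ => Finset.card_le_card (block_mono h v)

theorem block_subset (v : V) : net.block N j U v ⊆ (net.localInput N v).near U :=
  LocalInput.spanned_subset

theorem incidences_le (hU : U ⊆ net.idEdges) :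
    net.incidences N j U ≤ Fintype.card V * net.idEdges.card := by
  calc net.incidences N j U ≤ ∑ _v : V, net.idEdges.card :=
        Finset.sum_le_sum fun v _ => Finset.card_le_card
          ((block_subset v).trans (LocalInput.near_subset.trans hU))
    _ = _ := by simp

theorem block_eq_empty (hU : U ⊆ (net.startState N).uncovered) {v : V}
    (h : ((net.localInput N v).near U).Nonempty →
      (net.localInput N v).level ((net.localInput N v).near U) < j) :
    net.block N j U v = ∅ := by
  rcases ((net.localInput N v).near U).eq_empty_or_nonempty with h0 | h0
  · exact Finset.subset_empty.1 (h0 ▸ block_subset v)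
  · exact (regular_near hU v).spanned_star_eq_empty (h h0)

open Classical in
/-- In one iteration the number of incidences of the highest level drops in expectation by a
constant factor: an edge that is won by a vertex is covered, and then all its incidences vanish. -/
theorem sum_incidences_nextState_le {m : ℕ} (hm : 16 * Fintype.card V ^ 2 ≤ m)
    (hs : s.uncovered ⊆ (net.startState N).uncovered) {ℓ : ℤ}
    (htop : ∀ x, ((net.localInput N x).near s.uncovered).Nonempty →
      (net.localInput N x).level ((net.localInput N x).near s.uncovered) ≤ ℓ) :
    ∑ r : V → Fin m,
      (net.incidences N ℓ (net.nextState N s fun v => (r v : ℕ)).uncovered : ℝ) ≤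
      (m : ℝ) ^ Fintype.card V * (15 / 16 * net.incidences N ℓ s.uncovered) := by
  set U := s.uncovered with hU
  set C := net.block N ℓ U with hC
  have hlev : ∀ x, (C x).Nonempty →
      (net.localInput N x).level ((net.localInput N x).near U) = ℓ := by
    intro x hx
    by_contra hne
    refine hx.ne_empty (block_eq_empty hs fun h => lt_of_le_of_ne (htop x h) hne)
  have hspan : ∀ (r : V → ℕ) x, (net.proposal N U r x).level = ℓ →
      (net.proposal N U r x).span = C x := by
    intro r x hx
    subst hx
    rfl
  have hmain : ∀ r : V → Fin m,
      (net.incidences N ℓ (net.nextState N s fun v => (r v : ℕ)).uncovered : ℝ) +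
        ∑ v, ∑ e ∈ C v, (if r ∈ winning m net.ident C v e then ((holders C e).card : ℝ) else 0)
        ≤ net.incidences N ℓ U := by
    intro r
    set U' := (net.nextState N s fun v => (r v : ℕ)).uncovered with hU'
    have hUU : U' ⊆ U := uncovered_nextState_subset
    -- a won edge is covered
    have hwon : ∀ v, ∀ e ∈ C v, r ∈ winning m net.ident C v e → e ∉ U' := by
      intro v e he hw
      have hl := hlev v ⟨e, he⟩
      simp only [winning, Finset.mem_filter, Finset.mem_univ, true_and] at hw
      have hJ : net.Joins N U (fun v => (r v : ℕ)) v := by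
        refine ⟨⟨e, block_subset v he⟩, ?_⟩
        rw [Proposal.Joins, hspan _ v hl]
        refine hw.2.trans (Nat.mul_le_mul_left 8 (Finset.card_le_card fun e' he' => ?_))
        rw [Finset.mem_filter] at he'
        rw [mem_supporters, hspan _ v hl]
        refine ⟨he'.1, supports_of_isFirst htop hl (fun x hx hxe => ?_) he'.2⟩
        rw [hspan _ x hx] at hxe
        simpa [holders] using hxe
      refine Finset.disjoint_left.1 (span_disjoint_uncovered hJ) ?_
      rw [← hU, hspan _ v hl]
      exact he
    have h1 : ∑ v, ∑ e ∈ C v,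
        (if r ∈ winning m net.ident C v e then ((holders C e).card : ℝ) else 0) ≤
        ∑ e ∈ U \ U', ((holders C e).card : ℝ) := by
      simp only [← Finset.sum_filter]
      rw [← Finset.sum_biUnion]
      · refine Finset.sum_le_sum_of_subset_of_nonneg ?_ fun _ _ _ => Nat.cast_nonneg _
        intro e he
        obtain ⟨v, -, he⟩ := Finset.mem_biUnion.1 he
        rw [Finset.mem_filter] at he
        exact Finset.mem_sdiff.2
          ⟨LocalInput.near_subset (block_subset v he.1), hwon v e he.1 he.2⟩
      · intro v _ v' _ hne
        rw [Function.onFun, Finset.disjoint_left]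
        intro e he he'
        simp only [winning, Finset.mem_filter, Finset.mem_univ, true_and] at he he'
        exact hne (he.2.1.unique net.ident_injective he'.2.1 (by simp [holders, he.1])
          (by simp [holders, he'.1]))
    have h2 : ∑ e ∈ U \ U', ((holders C e).card : ℝ) = ∑ v, ((C v \ U').card : ℝ) := by
      have : ∑ e ∈ U \ U', (holders C e).card = ∑ v, (C v \ U').card := by
        simp only [holders, Finset.card_filter]
        rw [Finset.sum_comm]
        refine Finset.sum_congr rfl fun v _ => ?_
        rw [← Finset.card_filter]
        congr 1
        ext e
        simp only [Finset.mem_filter, Finset.mem_sdiff]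
        constructor
        · rintro ⟨⟨-, h⟩, h'⟩
          exact ⟨h', h⟩
        · rintro ⟨h, h'⟩
          exact ⟨⟨LocalInput.near_subset (block_subset v h), h'⟩, h⟩
      exact_mod_cast this
    have h3 : ∀ v, (net.block N ℓ U' v).card + (C v \ U').card ≤ (C v).card := by
      intro v
      rw [← Finset.card_union_of_disjoint]
      · exact Finset.card_le_card (Finset.union_subset (block_mono hUU v) Finset.sdiff_subset)
      · rw [Finset.disjoint_left]
        intro e he he'
        exact (Finset.mem_sdiff.1 he').2 (LocalInput.near_subset (block_subset v he))
    have h4 : (net.incidences N ℓ U' : ℝ) + ∑ v, ((C v \ U').card : ℝ) ≤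
        net.incidences N ℓ U := by
      have : net.incidences N ℓ U' + ∑ v, (C v \ U').card ≤ net.incidences N ℓ U := by
        rw [incidences, incidences, ← Finset.sum_add_distrib]
        exact Finset.sum_le_sum fun v _ => h3 v
      exact_mod_cast this
    linarith
  have h1 := Finset.sum_le_sum fun (r : V → Fin m) (_ : r ∈ Finset.univ) => hmain r
  rw [Finset.sum_add_distrib, Finset.sum_const, nsmul_eq_mul] at h1
  have h2 := le_sum_won (m := m) (ident := net.ident) (C := C) hm
  have h3 : ((Finset.univ : Finset (V → Fin m)).card : ℝ) = (m : ℝ) ^ Fintype.card V := by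
    simp
  have h4 : (net.incidences N ℓ U : ℝ) = ∑ v, ((C v).card : ℝ) := by
    rw [incidences]; push_cast; rfl
  rw [h3] at h1
  rw [← h4] at h2
  linarith

open Classical in
/-- In one iteration the potential drops in expectation by a constant factor: the highest level
makes up at least half of it, and the stars of this level are taken wherever they win. -/
theorem sum_potential_nextState_le {m : ℕ} (hm : 16 * Fintype.card V ^ 2 ≤ m)
    (hs : s.uncovered ⊆ (net.startState N).uncovered) {j₀ : ℤ} {K B : ℕ}
    (hB : Fintype.card V * net.idEdges.card + 1 ≤ B)
    (hK : ∀ x, ((net.localInput N x).near s.uncovered).Nonempty →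
      j₀ ≤ (net.localInput N x).level ((net.localInput N x).near s.uncovered) ∧
      (net.localInput N x).level ((net.localInput N x).near s.uncovered) < j₀ + K) :
    ∑ r : V → Fin m,
      (net.potential N j₀ K B (net.nextState N s fun v => (r v : ℕ)).uncovered : ℝ) ≤
      (m : ℝ) ^ Fintype.card V * (31 / 32 * net.potential N j₀ K B s.uncovered) := by
  rcases s.uncovered.eq_empty_or_nonempty with h0 | h0
  · have hzero : ∀ U ⊆ s.uncovered, net.potential N j₀ K B U = 0 := by
      intro U hU
      rw [h0] at hU
      refine Finset.sum_eq_zero fun k _ => mul_eq_zero_of_right _ (Finset.sum_eq_zero fun v _ => ?_)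
      rw [Finset.card_eq_zero, ← Finset.subset_empty]
      exact (block_subset v).trans (LocalInput.near_subset.trans hU)
    rw [hzero _ subset_rfl, Finset.sum_eq_zero]
    · simp
    · intro r _
      rw [hzero _ uncovered_nextState_subset, Nat.cast_zero]
  obtain ⟨v₀, hv₀, htop⟩ := exists_top (N := N) (hs.trans uncovered_startState_subset) h0
  set ℓ := (net.localInput N v₀).level ((net.localInput N v₀).near s.uncovered) with hℓ
  obtain ⟨k₀, hk₀⟩ := Int.eq_ofNat_of_zero_le (sub_nonneg.2 (hK v₀ hv₀).1)
  have hk₀K : k₀ < K := by have := (hK v₀ hv₀).2; omega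
  have hℓk : j₀ + k₀ = ℓ := by omega
  have hΦ : 1 ≤ net.incidences N ℓ s.uncovered := by
    have h1 : (net.block N ℓ s.uncovered v₀).Nonempty := by
      refine (regular_near hs v₀).spanned_star_nonempty ?_
      rw [near_near]
      exact hv₀
    exact (Nat.succ_le_iff.2 (Finset.card_pos.2 h1)).trans (Finset.single_le_sum
      (f := fun v => (net.block N ℓ s.uncovered v).card) (fun _ _ => Nat.zero_le _)
      (Finset.mem_univ v₀))
  have hhigh : ∀ k, k₀ < k → net.incidences N (j₀ + k) s.uncovered = 0 := by
    intro k hk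
    refine Finset.sum_eq_zero fun v _ => ?_
    rw [block_eq_empty hs fun h => (htop v h).trans_lt (by omega), Finset.card_empty]
  -- the highest level makes up at least half of the potential
  have hhalf : net.potential N j₀ K B s.uncovered ≤
      2 * (B ^ k₀ * net.incidences N ℓ s.uncovered) := by
    have hgeom : ∀ k, ∑ i ∈ Finset.range k, B ^ i * net.incidences N (j₀ + i) s.uncovered ≤
        B ^ k := by
      intro k
      induction k with
      | zero => simp
      | succ k ih =>
        rw [Finset.sum_range_succ]
        have h1 : net.incidences N (j₀ + k) s.uncovered + 1 ≤ B :=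
          (Nat.add_le_add_right (incidences_le (hs.trans uncovered_startState_subset)) 1).trans hB
        calc _ ≤ B ^ k + B ^ k * net.incidences N (j₀ + k) s.uncovered :=
              Nat.add_le_add_right ih _
          _ = B ^ k * (net.incidences N (j₀ + k) s.uncovered + 1) := by ring
          _ ≤ B ^ k * B := Nat.mul_le_mul_left _ h1
          _ = B ^ (k + 1) := (pow_succ _ _).symm
    have hsplit : net.potential N j₀ K B s.uncovered =
        ∑ i ∈ Finset.range (k₀ + 1), B ^ i * net.incidences N (j₀ + i) s.uncovered := by
      refine (Finset.sum_subset ?_ fun k _ hk => ?_).symm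
      · intro k hk
        rw [Finset.mem_range] at hk ⊢
        omega
      · rw [hhigh k (by rw [Finset.mem_range] at hk; omega), mul_zero]
    rw [hsplit, Finset.sum_range_succ, hℓk, two_mul]
    exact Nat.add_le_add_right ((hgeom k₀).trans (Nat.le_mul_of_pos_right _ hΦ)) _
  have hdrop : ∀ U' ⊆ s.uncovered, (net.potential N j₀ K B U' : ℝ) ≤
      net.potential N j₀ K B s.uncovered - (B : ℝ) ^ k₀ * net.incidences N ℓ s.uncovered +
        (B : ℝ) ^ k₀ * net.incidences N ℓ U' := by
    intro U' hU'
    have h1 : ∀ U, net.potential N j₀ K B U = B ^ k₀ * net.incidences N ℓ U +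
        ∑ k ∈ (Finset.range K).erase k₀, B ^ k * net.incidences N (j₀ + k) U := by
      intro U
      rw [potential, ← Finset.add_sum_erase _ _ (Finset.mem_range.2 hk₀K), hℓk]
    have h2 : ∑ k ∈ (Finset.range K).erase k₀, B ^ k * net.incidences N (j₀ + k) U' ≤
        ∑ k ∈ (Finset.range K).erase k₀, B ^ k * net.incidences N (j₀ + k) s.uncovered :=
      Finset.sum_le_sum fun k _ => Nat.mul_le_mul_left _ (incidences_mono hU')
    have h3 : net.potential N j₀ K B U' + B ^ k₀ * net.incidences N ℓ s.uncovered ≤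
        net.potential N j₀ K B s.uncovered + B ^ k₀ * net.incidences N ℓ U' := by
      rw [h1, h1 s.uncovered]
      omega
    have h4 : (net.potential N j₀ K B U' : ℝ) + (B : ℝ) ^ k₀ * net.incidences N ℓ s.uncovered ≤
        net.potential N j₀ K B s.uncovered + (B : ℝ) ^ k₀ * net.incidences N ℓ U' := by
      exact_mod_cast h3
    linarith
  have h1 := Finset.sum_le_sum fun (r : V → Fin m) (_ : r ∈ Finset.univ) =>
    hdrop (net.nextState N s fun v => (r v : ℕ)).uncovered uncovered_nextState_subset
  rw [Finset.sum_add_distrib, Finset.sum_const, nsmul_eq_mul, ← Finset.mul_sum] at h1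
  have h2 := sum_incidences_nextState_le hm hs htop
  have h3 : ((Finset.univ : Finset (V → Fin m)).card : ℝ) = (m : ℝ) ^ Fintype.card V := by
    simp
  have h4 : (net.potential N j₀ K B s.uncovered : ℝ) ≤
      2 * ((B : ℝ) ^ k₀ * net.incidences N ℓ s.uncovered) := by exact_mod_cast hhalf
  rw [h3] at h1
  have hB0 : (0 : ℝ) ≤ (B : ℝ) ^ k₀ := by positivity
  have h5 := mul_le_mul_of_nonneg_left h2 hB0
  have hm0 : (0 : ℝ) ≤ (m : ℝ) ^ Fintype.card V := by positivity
  have h6 := mul_le_mul_of_nonneg_left h4 hm0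
  refine h1.trans ?_
  generalize (m : ℝ) ^ Fintype.card V = a at *
  generalize (B : ℝ) ^ k₀ = b at *
  nlinarith

theorem one_le_potential (hU : U ⊆ (net.startState N).uncovered) (hne : U.Nonempty)
    {j₀ : ℤ} {K B : ℕ} (hB : 1 ≤ B)
    (hK : ∀ x, ((net.localInput N x).near U).Nonempty →
      j₀ ≤ (net.localInput N x).level ((net.localInput N x).near U) ∧
      (net.localInput N x).level ((net.localInput N x).near U) < j₀ + K) :
    1 ≤ net.potential N j₀ K B U := by
  obtain ⟨v, hv⟩ := near_nonempty_of_nonempty (N := N) (hU.trans uncovered_startState_subset) hne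
  obtain ⟨k, hk⟩ := Int.eq_ofNat_of_zero_le (sub_nonneg.2 (hK v hv).1)
  have hkK : k < K := by have := (hK v hv).2; omega
  have h1 : (net.block N (j₀ + k) U v).Nonempty := by
    rw [show j₀ + (k : ℤ) = (net.localInput N v).level ((net.localInput N v).near U) by omega]
    refine (regular_near hU v).spanned_star_nonempty ?_
    rw [near_near]
    exact hv
  have h2 : 1 ≤ net.incidences N (j₀ + k) U :=
    (Nat.succ_le_iff.2 (Finset.card_pos.2 h1)).trans (Finset.single_le_sum
      (f := fun v => (net.block N (j₀ + k) U v).card) (fun _ _ => Nat.zero_le _)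
      (Finset.mem_univ v))
  calc 1 ≤ B ^ k * net.incidences N (j₀ + k) U := Nat.one_le_iff_ne_zero.2
        (Nat.mul_ne_zero (pow_pos hB k).ne' (by omega))
    _ ≤ _ := Finset.single_le_sum (f := fun k : ℕ => B ^ k * net.incidences N (j₀ + k) U)
        (fun _ _ => Nat.zero_le _) (Finset.mem_range.2 hkK)

theorem potential_le (hU : U ⊆ net.idEdges) {j₀ : ℤ} {K B : ℕ}
    (hB : Fintype.card V * net.idEdges.card + 1 ≤ B) : net.potential N j₀ K B U ≤ B ^ K := by
  induction K with
  | zero => simp [potential]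
  | succ K ih =>
    rw [potential, Finset.sum_range_succ]
    have h1 : net.incidences N (j₀ + K) U + 1 ≤ B :=
      (Nat.add_le_add_right (incidences_le hU) 1).trans hB
    calc _ ≤ B ^ K + B ^ K * net.incidences N (j₀ + K) U := Nat.add_le_add_right ih _
      _ = B ^ K * (net.incidences N (j₀ + K) U + 1) := by ring
      _ ≤ B ^ K * B := Nat.mul_le_mul_left _ h1
      _ = B ^ (K + 1) := (pow_succ _ _).symm

end WeightedNetwork
end

/-! ### The distributed implementation -/

noncomputable section

/-- The state of a vertex. An iteration takes four rounds, numbered by `phase`. -/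
structure VertexState where
  inp : LocalInput
  phase : ℕ
  /-- The leaves of the stars that the vertex has taken. -/
  chosen : Finset ℕ
  /-- The neighbors to which the edge is not yet covered. -/
  pending : Finset ℕ
  /-- The proposal of the present iteration. -/
  proposal : Proposal
  /-- The proposals in the closed neighborhood. -/
  heard : Set Proposal
  done : Bool

namespace VertexState

open Classical in
/-- The uncovered edges in the closed neighborhood, read off the states `X` in it. -/
def knownEdges (s : VertexState) (X : Set VertexState) : Finset (Sym2 ℕ) :=
  (insert s.inp.ident s.inp.nbrs).sym2.filter fun e =>
    ∃ x ∈ X, ∃ b ∈ x.pending, e = s(x.inp.ident, b)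

open Classical in
/-- One round of a vertex in state `s` with random number `r`, where `X` is the set of the states
of the running vertices in its closed neighborhood. The vertex deletes the pending edges that have
been covered (phase 0), proposes a star, or terminates if no edge in its closed neighborhood is
uncovered (phase 1), collects the proposals (phase 2), and decides about its star (phase 3). -/
def update (s : VertexState) (r : ℕ) (X : Set VertexState) : VertexState :=
  if s.phase = 0 then
    { s with
      phase := 1
      pending := s.pending.filter fun b =>
        ∀ x ∈ X, s(s.inp.ident, b) ∉ (insert x.inp.ident x.chosen).sym2 }
  else if s.phase = 1 then
    if s.knownEdges X = ∅ then { s with done := true }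
    else { s with phase := 2, proposal := ⟨s.inp, s.knownEdges X, r⟩ }
  else if s.phase = 2 then
    { s with phase := 3, heard := VertexState.proposal '' X }
  else
    { s with
      phase := 0
      chosen :=
        if s.proposal.Joins (⋃ x ∈ X, x.heard) then s.chosen ∪ s.proposal.star else s.chosen }

end VertexState

/-- The algorithm: in each round a vertex sends its whole state to its neighbors. The range of the
random numbers is chosen such that among at most `N` vertices two equal numbers are unlikely. -/
def spannerAlgorithm : LocalAlgorithm where
  State := VertexState
  Msg := VertexState
  coinMax N := 16 * N ^ 2
  init I :=
    { inp := I, phase := 0, chosen := I.zeroLeaves, pending := I.nbrs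
      proposal := ⟨I, ∅, 0⟩, heard := ∅, done := false }
  send s _ _ := s
  receive s r M := s.update r (insert s (Prod.snd '' M))
  output s := if s.done then some s.chosen else none

namespace WeightedNetwork

variable {V : Type} (net : WeightedNetwork V)

/-- The states of the running vertices in the closed neighborhood of `v`. -/
def audible (st : V → VertexState) (v : V) : Set VertexState :=
  {x | ∃ u, (u = v ∨ net.graph.Adj v u) ∧ (st u).done = false ∧ x = st u}

/-- One round of the whole network. -/
def round (st : V → VertexState) (r : V → ℕ) (v : V) : VertexState :=
  if (st v).done then st v else (st v).update (r v) (net.audible st v)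

variable {net} in
theorem round_of_done {st : V → VertexState} {r : V → ℕ} {v : V}
    (h : (st v).done = true) : net.round st r v = st v := by
  rw [round, if_pos h]

variable {net} in
theorem round_of_running {st : V → VertexState} {r : V → ℕ} {v : V}
    (h : (st v).done = false) :
    net.round st r v = (st v).update (r v) (net.audible st v) := by
  rw [round, if_neg (by simp [h])]

variable [Fintype V] (N : ℕ)

/-- The states of the vertices after `t` rounds. -/
def states (ω : spannerAlgorithm.Coins V N) (t : ℕ) : V → VertexState :=
  spannerAlgorithm.stateAfter net N ω t

theorem output_stateAfter (ω : spannerAlgorithm.Coins V N) (t : ℕ) (v : V) :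
    spannerAlgorithm.output (spannerAlgorithm.stateAfter net N ω t v) =
      if (net.states N ω t v).done then some (net.states N ω t v).chosen else none := rfl

theorem states_succ (ω : spannerAlgorithm.Coins V N) (t : ℕ) :
    net.states N ω (t + 1) = net.round (net.states N ω t) fun v => (ω (t, v) : ℕ) := by
  ext1 v
  change (if (if (net.states N ω t v).done then some (net.states N ω t v).chosen
      else none).isSome then net.states N ω t v
    else (net.states N ω t v).update (ω (t, v)) (insert (net.states N ω t v)
      (Prod.snd '' {p | ∃ u, net.graph.Adj v u ∧
        (if (net.states N ω t u).done then some (net.states N ω t u).chosen else none) = none ∧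
        p = (net.ident u, net.states N ω t u)}))) = _
  cases hv : (net.states N ω t v).done
  · rw [round_of_running hv]
    simp only [Bool.false_eq_true, if_false, Option.isSome_none]
    congr 1
    ext x
    simp only [audible, Set.mem_insert_iff, Set.mem_image, Set.mem_ofPred_eq]
    constructor
    · rintro (rfl | ⟨_, ⟨u, hu, hd, rfl⟩, rfl⟩)
      · exact ⟨v, Or.inl rfl, hv, rfl⟩
      · refine ⟨u, Or.inr hu, ?_, rfl⟩
        by_contra h
        simp [h] at hd
    · rintro ⟨u, rfl | hu, hd, rfl⟩
      · exact Or.inl rfl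
      · exact Or.inr ⟨_, ⟨u, hu, by simp [hd], rfl⟩, rfl⟩
  · rw [round_of_done hv]
    rfl

/-- The states `st` of the vertices at the beginning of phase `p` agree with the leaves `A` and
the set `U` of uncovered edges. -/
structure Sync (A : V → Finset ℕ) (U : Finset (Sym2 ℕ)) (p : ℕ) (st : V → VertexState) :
    Prop where
  inp : ∀ v, (st v).inp = net.localInput N v
  chosen : ∀ v, (st v).chosen = A v
  near_of_done : ∀ v, (st v).done = true → (net.localInput N v).near U = ∅
  phase : ∀ v, (st v).done = false → (st v).phase = p
  mem_pending : ∀ v, (st v).done = false → ∀ b, b ∈ (st v).pending ↔ s(net.ident v, b) ∈ U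

variable {net N} {A : V → Finset ℕ} {U : Finset (Sym2 ℕ)} {st : V → VertexState} {r : V → ℕ}

theorem Sync.running_of_mem {p : ℕ} (h : net.Sync N A U p st) {v : V} {e : Sym2 ℕ}
    (he : e ∈ (net.localInput N v).near U) : (st v).done = false := by
  by_contra hd
  rw [Bool.not_eq_false] at hd
  rw [h.near_of_done v hd] at he
  exact absurd he (Finset.notMem_empty _)

theorem eq_or_adj_of_mem_insert {S : Finset ℕ} {v u : V} (hS : S ⊆ net.neighborIdents v)
    (h : net.ident u ∈ insert (net.ident v) S) : u = v ∨ net.graph.Adj v u := by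
  rcases Finset.mem_insert.1 h with h | h
  · exact Or.inl (net.ident_injective h)
  · obtain ⟨w, hw, hwu⟩ := mem_neighborIdents.1 (hS h)
    exact Or.inr (net.ident_injective hwu ▸ hw)

theorem eq_or_adj_of_mem_near {v u : V} {e : Sym2 ℕ} (he : e ∈ (net.localInput N v).near U)
    (hu : net.ident u ∈ e) : u = v ∨ net.graph.Adj v u := by
  rw [LocalInput.near, LocalInput.mem_spanned, nbrs_localInput] at he
  exact eq_or_adj_of_mem_insert subset_rfl (he.2 _ hu)

/-- Phase 0. A vertex whose star covers an uncovered edge has not terminated, hence the ends of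
the edge hear of it. -/
theorem Sync.round_zero (h : net.Sync N A U 0 st)
    (hA : ∀ v, A v ⊆ net.neighborIdents v) :
    net.Sync N A (net.notSpanned A U) 1 (net.round st r) := by
  have hdone : ∀ v, (net.round st r v).done = (st v).done := by
    intro v
    cases hv : (st v).done
    · rw [round_of_running hv, VertexState.update, if_pos (h.phase v hv)]
      exact hv
    · rw [round_of_done hv, hv]
  refine ⟨fun v => ?_, fun v => ?_, fun v hv => ?_, fun v hv => ?_, fun v hv b => ?_⟩
  · cases hv : (st v).done
    · rw [round_of_running hv, VertexState.update, if_pos (h.phase v hv)]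
      exact h.inp v
    · rw [round_of_done hv, h.inp]
  · cases hv : (st v).done
    · rw [round_of_running hv, VertexState.update, if_pos (h.phase v hv)]
      exact h.chosen v
    · rw [round_of_done hv, h.chosen]
  · rw [hdone] at hv
    exact Finset.subset_empty.1 (h.near_of_done v hv ▸ LocalInput.near_mono notSpanned_subset)
  · rw [hdone] at hv
    rw [round_of_running hv, VertexState.update, if_pos (h.phase v hv)]
  · rw [hdone] at hv
    rw [round_of_running hv, VertexState.update, if_pos (h.phase v hv), mem_notSpanned]
    simp only [Finset.mem_filter, h.mem_pending v hv, h.inp v, ident_localInput]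
    refine and_congr_right fun hb => ⟨fun hx x hxe => ?_, ?_⟩
    · have hvx : net.ident v ∈ insert (net.ident x) (A x) :=
        Finset.mem_sym2_iff.1 hxe _ (Sym2.mem_mk_left _ _)
      have hadj := eq_or_adj_of_mem_insert (hA x) hvx
      have hnear : s(net.ident v, b) ∈ (net.localInput N x).near U := by
        rw [LocalInput.near, LocalInput.mem_spanned, nbrs_localInput]
        exact ⟨hb, fun y hy => Finset.insert_subset_insert _ (hA x)
          (Finset.mem_sym2_iff.1 hxe y hy)⟩
      refine hx (st x) ⟨x, hadj.imp Eq.symm SimpleGraph.Adj.symm, h.running_of_mem hnear, rfl⟩ ?_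
      rw [h.inp, h.chosen]
      exact hxe
    · rintro hx _ ⟨x, -, -, rfl⟩
      rw [h.inp, h.chosen]
      exact hx x

theorem Sync.knownEdges_eq (h : net.Sync N A U 1 st) (hU : U ⊆ net.idEdges) (v : V) :
    (st v).knownEdges (net.audible st v) = (net.localInput N v).near U := by
  ext e
  simp only [VertexState.knownEdges, Finset.mem_filter]
  rw [h.inp v, LocalInput.near, LocalInput.mem_spanned, Finset.mem_sym2_iff, and_comm]
  refine and_congr_left fun hN => ⟨?_, fun he => ?_⟩
  · rintro ⟨_, ⟨u, -, hd, rfl⟩, b, hb, rfl⟩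
    rw [h.inp]
    exact (h.mem_pending u hd b).1 hb
  · obtain ⟨a, b, hab, rfl⟩ := mem_idEdges.1 (hU he)
    have hnear : s(net.ident a, net.ident b) ∈ (net.localInput N v).near U := by
      rw [LocalInput.near, LocalInput.mem_spanned]
      exact ⟨he, hN⟩
    have hd := h.running_of_mem (mem_near_of_mem (N := N) hU he (Sym2.mem_mk_left _ _))
    refine ⟨st a, ⟨a, eq_or_adj_of_mem_near hnear (Sym2.mem_mk_left _ _), hd, rfl⟩,
      net.ident b, (h.mem_pending a hd _).2 he, ?_⟩
    rw [h.inp]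
    rfl

/-- Phase 1. The closed neighborhood is known completely, since the ends of an uncovered edge have
not terminated. Exactly the vertices without an uncovered edge there terminate. -/
theorem Sync.round_one (h : net.Sync N A U 1 st) (hU : U ⊆ net.idEdges) :
    net.Sync N A U 2 (net.round st r) ∧
      (∀ v, (net.localInput N v).near U = ∅ → (net.round st r v).done = true) ∧
      ∀ v, (net.round st r v).done = false →
        (net.round st r v).proposal = net.proposal N U r v := by
  have hrun : ∀ v, (st v).done = false → net.round st r v =
      if (net.localInput N v).near U = ∅ then { st v with done := true }
      else { st v with phase := 2, proposal := net.proposal N U r v } := by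
    intro v hv
    rw [round_of_running hv, VertexState.update, if_neg (by rw [h.phase v hv]; decide),
      if_pos (h.phase v hv), h.knownEdges_eq hU, proposal, ← h.inp v]
  have hrun' : ∀ v, (net.round st r v).done = false → (st v).done = false ∧
      net.round st r v = { st v with phase := 2, proposal := net.proposal N U r v } := by
    intro v hv
    cases hd : (st v).done
    · refine ⟨rfl, ?_⟩
      rw [hrun v hd] at hv ⊢
      split_ifs with h0
      · rw [if_pos h0] at hv
        simp at hv
      · rfl
    · rw [round_of_done hd, hd] at hv
      simp at hv
  refine ⟨⟨fun v => ?_, fun v => ?_, fun v hv => ?_, fun v hv => ?_, fun v hv b => ?_⟩,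
    fun v hv => ?_, fun v hv => ?_⟩
  · cases hd : (st v).done
    · rw [hrun v hd]
      split_ifs <;> exact h.inp v
    · rw [round_of_done hd, h.inp]
  · cases hd : (st v).done
    · rw [hrun v hd]
      split_ifs <;> exact h.chosen v
    · rw [round_of_done hd, h.chosen]
  · cases hd : (st v).done
    · by_contra h0
      rw [hrun v hd, if_neg h0] at hv
      rw [hd] at hv
      simp at hv
    · exact h.near_of_done v hd
  · rw [(hrun' v hv).2]
  · rw [(hrun' v hv).2]
    exact h.mem_pending v (hrun' v hv).1 b
  · cases hd : (st v).done
    · rw [hrun v hd, if_pos hv]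
    · rw [round_of_done hd, hd]
  · rw [(hrun' v hv).2]

/-- The proposals that `v` hears of in phase 2. -/
def nearProposals (net : WeightedNetwork V) (N : ℕ) (U : Finset (Sym2 ℕ)) (r : V → ℕ) (v : V) :
    Set Proposal :=
  {q | ∃ u, (u = v ∨ net.graph.Adj v u) ∧ ((net.localInput N u).near U).Nonempty ∧
    q = net.proposal N U r u}

/-- Phase 2. Every vertex learns the proposals in its closed neighborhood. -/
theorem Sync.round_two (h : net.Sync N A U 2 st)
    (hd : ∀ v, (net.localInput N v).near U = ∅ → (st v).done = true) {r' : V → ℕ}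
    (hp : ∀ v, (st v).done = false → (st v).proposal = net.proposal N U r v) :
    net.Sync N A U 3 (net.round st r') ∧
      (∀ v, (net.round st r' v).done = (st v).done) ∧
      ∀ v, (st v).done = false → (net.round st r' v).proposal = net.proposal N U r v ∧
        (net.round st r' v).heard = net.nearProposals N U r v := by
  have hrun : ∀ v, (st v).done = false → net.round st r' v =
      { st v with phase := 3, heard := net.nearProposals N U r v } := by
    intro v hv
    rw [round_of_running hv, VertexState.update, if_neg (by rw [h.phase v hv]; decide),
      if_neg (by rw [h.phase v hv]; decide), if_pos (h.phase v hv)]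
    congr 1
    ext q
    simp only [Set.mem_image, audible, nearProposals, Set.mem_ofPred_eq]
    constructor
    · rintro ⟨_, ⟨u, hu, hud, rfl⟩, rfl⟩
      refine ⟨u, hu, ?_, hp u hud⟩
      by_contra h0
      rw [hd u (Finset.not_nonempty_iff_eq_empty.1 h0)] at hud
      simp at hud
    · rintro ⟨u, hu, ⟨e, he⟩, rfl⟩
      have hud := h.running_of_mem he
      exact ⟨st u, ⟨u, hu, hud, rfl⟩, hp u hud⟩
  have hdone : ∀ v, (net.round st r' v).done = (st v).done := by
    intro v
    cases hv : (st v).done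
    · rw [hrun v hv]
      exact hv
    · rw [round_of_done hv, hv]
  refine ⟨⟨fun v => ?_, fun v => ?_, fun v hv => ?_, fun v hv => ?_, fun v hv b => ?_⟩,
    hdone, fun v hv => ?_⟩
  · cases hv : (st v).done
    · rw [hrun v hv]; exact h.inp v
    · rw [round_of_done hv, h.inp]
  · cases hv : (st v).done
    · rw [hrun v hv]; exact h.chosen v
    · rw [round_of_done hv, h.chosen]
  · exact h.near_of_done v (by rwa [hdone] at hv)
  · rw [hdone] at hv
    rw [hrun v hv]
  · rw [hdone] at hv
    rw [hrun v hv]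
    exact h.mem_pending v hv b
  · rw [hrun v hv]
    exact ⟨hp v hv, rfl⟩

/-- For the decision about a star, the proposals within distance two suffice: an end of an edge
that this star 2-spans has heard of all proposals for which the edge matters. -/
theorem joins_iff (hU : U ⊆ net.idEdges) {v : V} {Q : Set Proposal}
    (hQ : ∀ q, q ∈ Q ↔ ∃ u, (u = v ∨ net.graph.Adj v u) ∧
      ((net.localInput N u).near U).Nonempty ∧ q ∈ net.nearProposals N U r u) :
    (net.proposal N U r v).Joins Q ↔
      (net.proposal N U r v).Joins (Set.range (net.proposal N U r)) := by
  have : (net.proposal N U r v).supporters Q =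
      (net.proposal N U r v).supporters (Set.range (net.proposal N U r)) := by
    ext e
    rw [mem_supporters, mem_supporters]
    refine and_congr_right fun hspan => ⟨?_, ?_⟩
    · rintro h _ ⟨x, rfl⟩ hx
      refine h _ ((hQ _).2 ?_) hx
      have hx' : e ∈ (net.localInput N x).near U := hx
      have he := LocalInput.near_subset hx'
      obtain ⟨a, b, hab, rfl⟩ := mem_idEdges.1 (hU he)
      refine ⟨a, eq_or_adj_of_mem_near (span_subset v hspan) (Sym2.mem_mk_left _ _),
        ⟨_, mem_near_of_mem hU he (Sym2.mem_mk_left _ _)⟩, x, ?_, ⟨_, hx'⟩, rfl⟩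
      exact (eq_or_adj_of_mem_near hx' (Sym2.mem_mk_left _ _)).imp Eq.symm SimpleGraph.Adj.symm
    · rintro h q hq hqe
      obtain ⟨u, -, -, x, -, -, rfl⟩ := (hQ q).1 hq
      exact h _ ⟨x, rfl⟩ hqe
  rw [Proposal.Joins, Proposal.Joins, this]

/-- Phase 3. The local decisions are those of the global process. -/
theorem Sync.round_three {s : GlobalState V} (h : net.Sync N s.chosen s.uncovered 3 st)
    (hU : s.uncovered ⊆ net.idEdges)
    (hd : ∀ v, (net.localInput N v).near s.uncovered = ∅ → (st v).done = true) {r' : V → ℕ}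
    (hp : ∀ v, (st v).done = false → (st v).proposal = net.proposal N s.uncovered r v ∧
      (st v).heard = net.nearProposals N s.uncovered r v) :
    net.Sync N (net.nextState N s r).chosen s.uncovered 0 (net.round st r') := by
  set U := s.uncovered with hUdef
  have hne : ∀ v, (st v).done = false ↔ ((net.localInput N v).near U).Nonempty := by
    intro v
    constructor
    · intro hv
      by_contra h0
      rw [hd v (Finset.not_nonempty_iff_eq_empty.1 h0)] at hv
      simp at hv
    · rintro ⟨e, he⟩
      exact h.running_of_mem he
  have hrun : ∀ v, (st v).done = false → net.round st r' v =
      { st v with phase := 0, chosen := (net.nextState N s r).chosen v } := by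
    intro v hv
    rw [round_of_running hv, VertexState.update, if_neg (by rw [h.phase v hv]; decide),
      if_neg (by rw [h.phase v hv]; decide), if_neg (by rw [h.phase v hv]; decide)]
    congr 1
    have hJ : (st v).proposal.Joins (⋃ x ∈ net.audible st v, x.heard) ↔ net.Joins N U r v := by
      rw [(hp v hv).1, Joins, and_iff_right ((hne v).1 hv)]
      refine joins_iff hU fun q => ?_
      simp only [Set.mem_iUnion, audible, Set.mem_ofPred_eq, exists_prop]
      constructor
      · rintro ⟨_, ⟨u, hu, hud, rfl⟩, hq⟩
        exact ⟨u, hu, (hne u).1 hud, (hp u hud).2 ▸ hq⟩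
      · rintro ⟨u, hu, hud, hq⟩
        have hud := (hne u).2 hud
        exact ⟨st u, ⟨u, hu, hud, rfl⟩, (hp u hud).2.symm ▸ hq⟩
    simp only [nextState, nextChosen, h.chosen, ← hUdef]
    rw [(hp v hv).1] at hJ ⊢
    by_cases hc : net.Joins N U r v
    · rw [if_pos hc, if_pos (hJ.2 hc)]
    · rw [if_neg hc, if_neg (mt hJ.1 hc)]
  have hdone : ∀ v, (net.round st r' v).done = (st v).done := by
    intro v
    cases hv : (st v).done
    · rw [hrun v hv]
      exact hv
    · rw [round_of_done hv, hv]
  refine ⟨fun v => ?_, fun v => ?_, fun v hv => ?_, fun v hv => ?_, fun v hv b => ?_⟩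
  · cases hv : (st v).done
    · rw [hrun v hv]; exact h.inp v
    · rw [round_of_done hv, h.inp]
  · cases hv : (st v).done
    · rw [hrun v hv]
    · have hJ : ¬ net.Joins N U r v := fun hJ => by
        rw [(hne v).2 hJ.1] at hv
        simp at hv
      rw [round_of_done hv, h.chosen]
      simp only [nextState, nextChosen, ← hUdef, if_neg hJ]
  · exact h.near_of_done v (by rwa [hdone] at hv)
  · rw [hdone] at hv
    rw [hrun v hv]
  · rw [hdone] at hv
    rw [hrun v hv]
    exact h.mem_pending v hv b

/-- The random numbers that matter: those of the second round of each iteration. -/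
def coinRows (ω : spannerAlgorithm.Coins V N) (i : ℕ) (v : V) : ℕ := ω (4 * i + 1, v)

/-- After `4 * i + 1` rounds the states of the vertices agree with the state of the global
process after `i` iterations. -/
theorem sync_states (ω : spannerAlgorithm.Coins V N) (i : ℕ) :
    net.Sync N (net.run N (coinRows ω) i).chosen (net.run N (coinRows ω) i).uncovered 1
      (net.states N ω (4 * i + 1)) := by
  induction i with
  | zero =>
    have h0 : net.Sync N (fun v => (net.localInput N v).zeroLeaves) net.idEdges 0
        (net.states N ω 0) := by
      refine ⟨fun v => rfl, fun v => rfl, fun v hv => ?_, fun v _ => rfl, fun v _ b => ?_⟩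
      · exact absurd hv (by simp [states, LocalAlgorithm.stateAfter, spannerAlgorithm])
      · change b ∈ (net.localInput N v).nbrs ↔ _
        rw [nbrs_localInput, mem_neighborIdents, mem_idEdges]
        constructor
        · rintro ⟨u, hu, rfl⟩
          exact ⟨v, u, hu, rfl⟩
        · rintro ⟨u, w, huw, he⟩
          rw [Sym2.eq_iff] at he
          rcases he with ⟨h1, rfl⟩ | ⟨h1, rfl⟩
          · exact ⟨w, net.ident_injective h1 ▸ huw, rfl⟩
          · exact ⟨u, net.ident_injective h1 ▸ huw.symm, rfl⟩
    rw [states_succ]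
    exact h0.round_zero fun v => zeroLeaves_subset v
  | succ i ih =>
    have hU : (net.run N (coinRows ω) i).uncovered ⊆ net.idEdges :=
      (uncovered_run_subset _ i).trans uncovered_startState_subset
    obtain ⟨h2, hd2, hp2⟩ := ih.round_one (r := coinRows ω i) hU
    obtain ⟨h3, hd3, hp3⟩ := h2.round_two hd2 hp2 (r' := fun v => (ω (4 * i + 2, v) : ℕ))
    have h4 := h3.round_three (r := coinRows ω i) hU (fun v hv => (hd3 v).trans (hd2 v hv))
      (fun v hv => hp3 v ((hd3 v).symm.trans hv)) (r' := fun v => (ω (4 * i + 3, v) : ℕ))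
    have h5 := h4.round_zero (r := fun v => (ω (4 * i + 4, v) : ℕ))
      (chosen_run_subset (coinRows ω) (i + 1))
    rw [show 4 * (i + 1) + 1 = 4 * i + 1 + 1 + 1 + 1 + 1 by ring, states_succ,
      states_succ, states_succ, states_succ]
    exact h5

theorem allTerminated_iff (ω : spannerAlgorithm.Coins V N) (t : ℕ) :
    spannerAlgorithm.AllTerminated net N ω t ↔
      ∀ v, (net.states N ω t v).done = true := by
  refine forall_congr' fun v => ?_
  rw [output_stateAfter]
  split_ifs with h
  · simp [h]
  · simp [h]

theorem allTerminated_of_uncovered_eq_empty (ω : spannerAlgorithm.Coins V N) {i : ℕ}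
    (h : (net.run N (coinRows ω) i).uncovered = ∅) :
    spannerAlgorithm.AllTerminated net N ω (4 * i + 2) := by
  rw [allTerminated_iff, states_succ]
  have hU : (net.run N (coinRows ω) i).uncovered ⊆ net.idEdges := by simp [h]
  intro v
  refine ((sync_states ω i).round_one hU).2.1 v ?_
  rw [h]
  exact Finset.subset_empty.1 LocalInput.near_subset

theorem states_eq_of_allTerminated (ω : spannerAlgorithm.Coins V N) {t t' : ℕ} (h : t ≤ t')
    (ht : spannerAlgorithm.AllTerminated net N ω t) :
    net.states N ω t' = net.states N ω t := by
  induction t', h using Nat.le_induction with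
  | base => rfl
  | succ t' _ ih =>
    rw [states_succ, ih]
    ext1 v
    exact round_of_done ((allTerminated_iff ω t).1 ht v)

/-- When all vertices have terminated, all edges are covered, and the output of each vertex
consists of the leaves of the stars that it has taken. -/
theorem output_of_allTerminated (ω : spannerAlgorithm.Coins V N) {t : ℕ}
    (ht : spannerAlgorithm.AllTerminated net N ω t) :
    (net.run N (coinRows ω) t).uncovered = ∅ ∧
      ∀ v, spannerAlgorithm.output (spannerAlgorithm.stateAfter net N ω t v) =
        some ((net.run N (coinRows ω) t).chosen v) := by
  have heq := states_eq_of_allTerminated ω (show t ≤ 4 * t + 1 by omega) ht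
  have hsync := sync_states (net := net) ω t
  rw [heq] at hsync
  have hdone := (allTerminated_iff ω t).1 ht
  constructor
  · by_contra hne
    obtain ⟨v, hv⟩ := near_nonempty_of_nonempty (N := N)
      ((uncovered_run_subset (coinRows ω) t).trans uncovered_startState_subset)
      (Finset.nonempty_iff_ne_empty.2 hne)
    exact hv.ne_empty (hsync.near_of_done v (hdone v))
  · intro v
    rw [output_stateAfter, if_pos (hdone v), hsync.chosen]

end WeightedNetwork
end

/-! ### Output and running time -/

noncomputable section

namespace WeightedNetwork

theorem cost_nonneg {V : Type} {net : WeightedNetwork V} {H : Finset (Sym2 V)}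
    (hH : (H : Set (Sym2 V)) ⊆ net.graph.edgeSet) :
    0 ≤ net.cost H := Finset.sum_nonneg fun e he => net.weight_nonneg e (hH he)

variable {V : Type} [Fintype V] {net : WeightedNetwork V} {N : ℕ}

theorem half_le_log_max_two (x : ℝ) : 1 / 2 ≤ Real.log (max x 2) := by
  have h1 := Real.log_two_gt_d9
  have h2 : Real.log 2 ≤ Real.log (max x 2) := Real.log_le_log (by norm_num) (le_max_right _ _)
  linarith

theorem mem_outputEdges {ω : spannerAlgorithm.Coins V N} {t : ℕ}
    (ht : spannerAlgorithm.AllTerminated net N ω t) {e : Sym2 V} :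
    e ∈ spannerAlgorithm.outputEdges net N ω t ↔
      ∃ u v, net.ident v ∈ (net.run N (coinRows ω) t).chosen u ∧ e = s(u, v) := by
  have hout := (output_of_allTerminated ω ht).2
  simp only [LocalAlgorithm.outputEdges, Finset.mem_filter, Finset.mem_univ, true_and, hout,
    Option.some.injEq, exists_eq_left']

theorem isKSpanner_outputEdges {ω : spannerAlgorithm.Coins V N} {t : ℕ}
    (ht : spannerAlgorithm.AllTerminated net N ω t) :
    IsKSpanner net.graph 2 (spannerAlgorithm.outputEdges net N ω t) := by
  refine ⟨fun e he => ?_, fun u v huv => ?_⟩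
  · obtain ⟨a, b, hb, rfl⟩ := (mem_outputEdges ht).1 he
    obtain ⟨b', hb', heq⟩ := mem_neighborIdents.1 (chosen_run_subset _ _ _ hb)
    exact net.ident_injective heq ▸ hb'
  · obtain ⟨x, hx⟩ := exists_of_notMem_uncovered_run (coinRows ω) t
      (mem_idEdges.2 ⟨u, v, huv, rfl⟩)
      (by rw [(output_of_allTerminated ω ht).1]; exact Finset.notMem_empty _)
    rw [Finset.mem_sym2_iff] at hx
    have hadj : ∀ y, y ≠ x → net.ident y ∈
        insert (net.ident x) ((net.run N (coinRows ω) t).chosen x) →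
        (SimpleGraph.fromEdgeSet (spannerAlgorithm.outputEdges net N ω t : Set (Sym2 V))).Adj
          x y := by
      intro y hy h
      rw [SimpleGraph.fromEdgeSet_adj]
      refine ⟨(mem_outputEdges ht).2 ⟨x, y, ?_, rfl⟩, hy.symm⟩
      exact (Finset.mem_insert.1 h).resolve_left fun h => hy (net.ident_injective h)
    have hu := hx _ (Sym2.mem_mk_left _ _)
    have hv := hx _ (Sym2.mem_mk_right _ _)
    by_cases hux : u = x
    · subst hux
      exact ⟨(hadj v huv.ne' hv).toWalk, by simp [huv.ne], by simp⟩
    · by_cases hvx : v = x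
      · subst hvx
        exact ⟨(hadj u huv.ne hu).symm.toWalk, by simp [huv.ne], by simp⟩
      · exact ⟨.cons (hadj u hux hu).symm (hadj v hvx hv).toWalk,
          by simp [huv.ne, hux, Ne.symm hvx], by simp⟩

theorem cost_outputEdges_le {ω : spannerAlgorithm.Coins V N} {t : ℕ}
    (ht : spannerAlgorithm.AllTerminated net N ω t) :
    net.cost (spannerAlgorithm.outputEdges net N ω t) ≤
      ∑ v, (net.localInput N v).starWeight ((net.run N (coinRows ω) t).chosen v) := by
  classical
  have hw : ∀ e ∈ spannerAlgorithm.outputEdges net N ω t, 0 ≤ net.weight e := fun e he =>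
    net.weight_nonneg e ((isKSpanner_outputEdges ht).1 he)
  have h1 : ∀ u, (net.localInput N u).starWeight ((net.run N (coinRows ω) t).chosen u) =
      ∑ e ∈ spannerAlgorithm.outputEdges net N ω t,
        if ∃ v, net.ident v ∈ (net.run N (coinRows ω) t).chosen u ∧ e = s(u, v)
        then net.weight e else 0 := by
    intro u
    rw [starWeight_localInput, ← Finset.sum_filter]
    refine Finset.sum_bij (fun v _ => s(u, v)) ?_ ?_ ?_ fun _ _ => rfl
    · intro v hv
      rw [Finset.mem_filter] at hv ⊢
      exact ⟨(mem_outputEdges ht).2 ⟨u, v, hv.2, rfl⟩, v, hv.2, rfl⟩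
    · intro a _ b _ h
      exact Sym2.congr_right.1 h
    · intro e he
      obtain ⟨he, v, hv, rfl⟩ := Finset.mem_filter.1 he
      refine ⟨v, Finset.mem_filter.2 ⟨?_, hv⟩, rfl⟩
      simpa using (isKSpanner_outputEdges ht).1 he
  simp only [h1]
  rw [Finset.sum_comm, cost]
  refine Finset.sum_le_sum fun e he => ?_
  obtain ⟨u, v, hv, rfl⟩ := (mem_outputEdges ht).1 he
  refine le_trans (le_of_eq ?_) (Finset.single_le_sum (fun x _ => ?_) (Finset.mem_univ u))
  · rw [if_pos ⟨v, hv, rfl⟩]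
  · split_ifs
    · exact hw _ he
    · exact le_rfl

theorem cost_outputEdges_le_mul_log {ω : spannerAlgorithm.Coins V N} {t : ℕ}
    (ht : spannerAlgorithm.AllTerminated net N ω t) {H : Finset (Sym2 V)}
    (hH : IsKSpanner net.graph 2 H) :
    net.cost (spannerAlgorithm.outputEdges net N ω t) ≤
      192 * Real.log (max (net.maxDegree : ℝ) 2) * net.cost H := by
  refine (cost_outputEdges_le ht).trans ((sum_starWeight_run_le_cost _ _ hH).trans ?_)
  refine mul_le_mul_of_nonneg_right ?_ (cost_nonneg hH.1)
  have h1 := half_le_log_max_two (net.maxDegree : ℝ)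
  have hm := le_max_left (net.maxDegree : ℝ) 2
  have hm2 := le_max_right (net.maxDegree : ℝ) 2
  have h2 : Real.log ((net.maxDegree : ℝ) + 1) ≤ 2 * Real.log (max (net.maxDegree : ℝ) 2) := by
    rw [show (2 : ℝ) * Real.log (max (net.maxDegree : ℝ) 2) =
      Real.log (max (net.maxDegree : ℝ) 2 ^ 2) by rw [Real.log_pow]; norm_num]
    exact Real.log_le_log (by positivity) (by nlinarith)
  linarith

theorem finite_positiveWeights : net.positiveWeights.Finite := by
  classical
  refine (net.graph.edgeFinset.image net.weight).finite_toSet.subset ?_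
  rintro x ⟨-, e, he, rfl⟩
  simpa using ⟨e, he, rfl⟩

theorem sInf_positiveWeights_mem (h : net.positiveWeights.Nonempty) :
    sInf net.positiveWeights ∈ net.positiveWeights :=
  h.csInf_mem finite_positiveWeights

theorem sInf_positiveWeights_le {x : ℝ} (hx : x ∈ net.positiveWeights) :
    sInf net.positiveWeights ≤ x := csInf_le finite_positiveWeights.bddBelow hx

theorem le_sSup_positiveWeights {x : ℝ} (hx : x ∈ net.positiveWeights) :
    x ≤ sSup net.positiveWeights := le_csSup finite_positiveWeights.bddAbove hx

theorem sSup_positiveWeights_pos (h : net.positiveWeights.Nonempty) :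
    0 < sSup net.positiveWeights := by
  obtain ⟨x, hx⟩ := h
  exact hx.1.trans_le (le_sSup_positiveWeights hx)

theorem one_le_weightRatio : 1 ≤ net.weightRatio := by
  rw [weightRatio]
  split_ifs with h
  · rw [one_le_div (sInf_positiveWeights_mem h).1]
    exact le_sSup_positiveWeights (sInf_positiveWeights_mem h)
  · exact le_rfl

theorem starWeight_nbrs_le (h : net.positiveWeights.Nonempty) (v : V) :
    (net.localInput N v).starWeight (net.localInput N v).nbrs ≤
      max (net.maxDegree : ℝ) 2 * sSup net.positiveWeights := by
  classical
  rw [starWeight_localInput]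
  have hpos := sSup_positiveWeights_pos h
  have h1 : ∀ u ∈ (net.graph.neighborFinset v).filter
      (fun u => net.ident u ∈ (net.localInput N v).nbrs),
      net.weight s(v, u) ≤ sSup net.positiveWeights := by
    intro u hu
    have hadj : s(v, u) ∈ net.graph.edgeSet := by simpa using (Finset.mem_filter.1 hu).1
    rcases lt_or_eq_of_le (net.weight_nonneg _ hadj) with h0 | h0
    · exact le_sSup_positiveWeights ⟨h0, _, hadj, rfl⟩
    · rw [← h0]; exact hpos.le
  refine (Finset.sum_le_card_nsmul _ _ _ h1).trans ?_
  rw [nsmul_eq_mul]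
  refine mul_le_mul_of_nonneg_right (le_trans ?_ (le_max_left _ _)) hpos.le
  have h2 : (net.graph.neighborFinset v).card ≤ net.maxDegree := by
    rw [maxDegree, SimpleGraph.card_neighborFinset_eq_degree]
    exact SimpleGraph.degree_le_maxDegree _ _
  exact_mod_cast (Finset.card_filter_le _ _).trans h2

variable {U : Finset (Sym2 ℕ)}

/-- The levels that can occur during a run of the algorithm. The star of all neighbors weighs at
most `max Δ 2 * sSup`, and a star that 2-spans an uncovered edge weighs at least `sInf` and 2-spans at
most `(Δ + 1) ^ 2 ≤ (max Δ 2) ^ 4` edges. -/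
theorem level_bounds (hU : U ⊆ (net.startState N).uncovered) {v : V}
    (hne : ((net.localInput N v).near U).Nonempty) :
    Int.clog 2 (1 / (max (net.maxDegree : ℝ) 2 * sSup net.positiveWeights)) - 1 ≤
      (net.localInput N v).level ((net.localInput N v).near U) ∧
    (net.localInput N v).level ((net.localInput N v).near U) ≤
      Int.clog 2 (max (net.maxDegree : ℝ) 2 ^ 4 / sInf net.positiveWeights) - 1 := by
  have hreg := regular_near hU v
  have hne' : ((net.localInput N v).near ((net.localInput N v).near U)).Nonempty := by
    rwa [near_near]
  obtain ⟨x, hx, -⟩ := exists_positiveWeight_le hU subset_rfl hne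
  have hP : net.positiveWeights.Nonempty := ⟨x, hx⟩
  have hm2 : (2 : ℝ) ≤ max (net.maxDegree : ℝ) 2 := le_max_right _ _
  have hsup := sSup_positiveWeights_pos hP
  have hinf := (sInf_positiveWeights_mem hP).1
  have hpos := hreg.density_pos hne'
  constructor
  · refine sub_le_sub_right (Int.clog_mono_right (by positivity) ?_) 1
    refine le_trans ?_ (LocalInput.le_density subset_rfl)
    have hw := hreg.pos _ subset_rfl hne'
    have hcard : (1 : ℝ) ≤ ((net.localInput N v).spanned (net.localInput N v).nbrs
        ((net.localInput N v).near U)).card := by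
      exact_mod_cast Finset.card_pos.2 hne'
    exact div_le_div₀ (by positivity) hcard hw (starWeight_nbrs_le hP v)
  · refine sub_le_sub_right (Int.clog_mono_right hpos ?_) 1
    refine Finset.sup'_le _ _ fun S hS => ?_
    rw [Finset.mem_powerset] at hS
    rcases ((net.localInput N v).spanned S
      ((net.localInput N v).near U)).eq_empty_or_nonempty with h0 | h0
    · rw [h0, Finset.card_empty, Nat.cast_zero, zero_div]
      positivity
    · obtain ⟨y, hy, hyS⟩ := exists_positiveWeight_le
        (LocalInput.near_subset.trans hU) hS h0
      have hc := card_spanned_le (net := net) (N := N) (U := (net.localInput N v).near U)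
        (v := v) (S := S) (by rwa [nbrs_localInput] at hS)
      refine div_le_div₀ (by positivity) ?_ hinf ((sInf_positiveWeights_le hy).trans hyS)
      have hc' : (((net.localInput N v).spanned S ((net.localInput N v).near U)).card : ℝ) ≤
          ((net.maxDegree : ℝ) + 1) ^ 2 := by exact_mod_cast hc
      refine hc'.trans ?_
      have hm := le_max_left (net.maxDegree : ℝ) 2
      have h1 : (net.maxDegree : ℝ) + 1 ≤ max (net.maxDegree : ℝ) 2 ^ 2 := by nlinarith
      calc ((net.maxDegree : ℝ) + 1) ^ 2 ≤ (max (net.maxDegree : ℝ) 2 ^ 2) ^ 2 := by gcongr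
        _ = _ := by ring

theorem clog_sub_clog_le {a b : ℝ} (hb : 0 < b) (hab : b ≤ a) :
    ((Int.clog 2 a : ℝ) - Int.clog 2 b) * Real.log 2 ≤ Real.log (a / b) + Real.log 2 := by
  have ha : 0 < a := hb.trans_le hab
  have h1 : ((Int.clog 2 a : ℝ) - 1) * Real.log 2 ≤ Real.log a := by
    have := Int.zpow_pred_clog_lt_self (b := 2) (by norm_num) ha
    have h2 := Real.log_le_log (by positivity) this.le
    rw [Real.log_zpow] at h2
    push_cast at h2
    exact h2
  have h2 : Real.log b ≤ Int.clog 2 b * Real.log 2 := by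
    have := Int.self_le_zpow_clog (b := 2) (by norm_num) b
    have h2 := Real.log_le_log hb this
    rw [Real.log_zpow] at h2
    push_cast at h2
    exact h2
  rw [Real.log_div ha.ne' hb.ne']
  linarith

/-- The number of levels is logarithmic. -/
theorem exists_levels (hP : net.positiveWeights.Nonempty) : ∃ (j₀ : ℤ) (K : ℕ),
    (K : ℝ) ≤ 14 * Real.log (max (net.maxDegree : ℝ) 2 * net.weightRatio) ∧
    ∀ N, ∀ U ⊆ (net.startState N).uncovered, ∀ x, ((net.localInput N x).near U).Nonempty →
      j₀ ≤ (net.localInput N x).level ((net.localInput N x).near U) ∧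
      (net.localInput N x).level ((net.localInput N x).near U) < j₀ + K := by
  set m := max (net.maxDegree : ℝ) 2 with hm
  have hm2 : (2 : ℝ) ≤ m := le_max_right _ _
  have hsup := sSup_positiveWeights_pos hP
  have hinf := (sInf_positiveWeights_mem hP).1
  have hle := le_sSup_positiveWeights (sInf_positiveWeights_mem hP)
  set a := m ^ 4 / sInf net.positiveWeights with ha
  set b := 1 / (m * sSup net.positiveWeights) with hb
  have hb0 : 0 < b := by positivity
  have hab : b ≤ a := by
    rw [ha, hb]
    refine div_le_div₀ (by positivity) (one_le_pow₀ (by linarith)) hinf ?_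
    nlinarith
  have hclog : Int.clog 2 b ≤ Int.clog 2 a := Int.clog_mono_right hb0 hab
  obtain ⟨K, hK⟩ := Int.eq_ofNat_of_zero_le (show 0 ≤ Int.clog 2 a - Int.clog 2 b + 1 by omega)
  refine ⟨Int.clog 2 b - 1, K, ?_, fun N U hU x hx => ?_⟩
  · have hW := one_le_weightRatio (net := net)
    have h1 : a / b = m ^ 5 * net.weightRatio := by
      rw [weightRatio, if_pos hP, ha, hb]
      field_simp
    have h2 := clog_sub_clog_le hb0 hab
    rw [h1, Real.log_mul (by positivity) (by positivity), Real.log_pow] at h2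
    have h3 : (K : ℝ) = Int.clog 2 a - Int.clog 2 b + 1 := by
      have : ((Int.clog 2 a - Int.clog 2 b + 1 : ℤ) : ℝ) = ((K : ℤ) : ℝ) := by rw [hK]
      push_cast at this
      exact this.symm
    have h4 := half_le_log_max_two (net.maxDegree : ℝ)
    rw [← hm] at h4
    have h5 := Real.log_nonneg hW
    have h6 := Real.log_two_gt_d9
    have h7 := Real.log_two_lt_d9
    rw [Real.log_mul (by positivity) (by positivity)]
    push_cast at h2
    have h8 : (K : ℝ) * Real.log 2 ≤ 5 * Real.log m + Real.log net.weightRatio +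
        2 * Real.log 2 := by
      rw [h3]
      linarith
    have h9 : (K : ℝ) * (1 / 2) ≤ K * Real.log 2 :=
      mul_le_mul_of_nonneg_left (by linarith) (Nat.cast_nonneg K)
    have h10 : Real.log 2 ≤ Real.log m := Real.log_le_log (by norm_num) hm2
    linarith
  · have := level_bounds hU hx
    rw [← hm, ← ha, ← hb] at this
    omega

theorem card_idEdges_le : net.idEdges.card ≤ Fintype.card V ^ 2 := by
  classical
  refine Finset.card_image_le.trans (SimpleGraph.card_edgeFinset_le_card_choose_two.trans ?_)
  exact Nat.choose_le_pow _ _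

theorem coinMeasure_spannerAlgorithm (V : Type) (N : ℕ) :
    spannerAlgorithm.coinMeasure V N = uniformCoins V (16 * N ^ 2) := rfl

/-- The probability that an edge is still uncovered after `T` iterations decays exponentially. -/
theorem measureReal_uncovered_nonempty_le (hN : Fintype.card V ≤ N) {j₀ : ℤ} {K : ℕ}
    (hK : ∀ U ⊆ (net.startState N).uncovered, ∀ x, ((net.localInput N x).near U).Nonempty →
      j₀ ≤ (net.localInput N x).level ((net.localInput N x).near U) ∧
      (net.localInput N x).level ((net.localInput N x).near U) < j₀ + K) (T : ℕ) :
    (spannerAlgorithm.coinMeasure V N).real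
      {ω | (net.run N (coinRows ω) T).uncovered.Nonempty} ≤
      (31 / 32 : ℝ) ^ T * ((Fintype.card V * net.idEdges.card + 1 : ℕ) : ℝ) ^ K := by
  classical
  set B := Fintype.card V * net.idEdges.card + 1 with hB
  rw [coinMeasure_spannerAlgorithm]
  have hτ : StrictMono fun i => 4 * i + 1 := fun a b h => by dsimp only; omega
  obtain ⟨hint, hle⟩ := integral_chain_le (M := 16 * N ^ 2) (fun s r => net.nextState N s r) hτ
    (fun ω i => net.run N (fun i v => (ω (4 * i + 1, v) : ℕ)) i) (net.startState N)
    (fun _ => rfl) (fun _ _ => rfl) (fun s => (net.potential N j₀ K B s.uncovered : ℝ))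
    (q := 31 / 32) (by norm_num)
    (fun ω i => by
      have hsub := uncovered_run_subset (net := net) (N := N)
        (fun i v => (ω (4 * i + 1, v) : ℕ)) i
      refine sum_potential_nextState_le ?_ hsub le_rfl (hK _ hsub)
      have := Nat.pow_le_pow_left hN 2
      omega) T
  have hmarkov := mul_meas_ge_le_integral_of_nonneg
    (Filter.Eventually.of_forall fun ω => Nat.cast_nonneg _) hint 1
  rw [one_mul] at hmarkov
  refine le_trans (measureReal_mono ?_) (hmarkov.trans (hle.trans ?_))
  · intro ω hω
    have hsub := uncovered_run_subset (net := net) (N := N)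
      (fun i v => (ω (4 * i + 1, v) : ℕ)) T
    have := one_le_potential hsub hω (B := B) (by omega) (hK _ hsub)
    change (1 : ℝ) ≤ _
    exact_mod_cast this
  · refine mul_le_mul_of_nonneg_left ?_ (by positivity)
    exact_mod_cast potential_le uncovered_startState_subset le_rfl

/-- The number `T` of iterations that suffices, from `31 / 32 ≤ exp (-1 / 32)`. -/
theorem pow_mul_pow_le {n c b : ℝ} (hn : 1 ≤ n) (hb : 1 ≤ b) {K T : ℕ}
    (hT : 32 * (K * Real.log b + c * Real.log n) ≤ T) :
    (31 / 32 : ℝ) ^ T * b ^ K ≤ 1 / n ^ c := by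
  have h1 : (31 / 32 : ℝ) ^ T ≤ Real.exp (-(T / 32)) := by
    have h := Real.one_sub_le_exp_neg (1 / 32 : ℝ)
    calc (31 / 32 : ℝ) ^ T ≤ Real.exp (-(1 / 32)) ^ T :=
          pow_le_pow_left₀ (by norm_num) (by linarith) T
      _ = _ := by
          rw [← Real.exp_nat_mul]
          congr 1
          ring
  have h2 : b ^ K = Real.exp (K * Real.log b) := by
    rw [Real.exp_nat_mul, Real.exp_log (by linarith)]
  have h3 : 1 / n ^ c = Real.exp (-(c * Real.log n)) := by
    rw [Real.rpow_def_of_pos (by linarith), Real.exp_neg, one_div, mul_comm]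
  rw [h2, h3]
  calc _ ≤ Real.exp (-(T / 32)) * Real.exp (K * Real.log b) :=
        mul_le_mul_of_nonneg_right h1 (Real.exp_pos _).le
    _ = Real.exp (-(T / 32) + K * Real.log b) := (Real.exp_add _ _).symm
    _ ≤ _ := Real.exp_le_exp.2 (by linarith)

theorem log_max_mul_weightRatio_ge :
    1 / 2 ≤ Real.log (max (net.maxDegree : ℝ) 2 * net.weightRatio) := by
  have h1 := half_le_log_max_two (net.maxDegree : ℝ)
  have h2 : (2 : ℝ) ≤ max (net.maxDegree : ℝ) 2 := le_max_right _ _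
  refine h1.trans (Real.log_le_log (by linarith) ?_)
  exact le_mul_of_one_le_right (by linarith) one_le_weightRatio

/-- With high probability the algorithm stops within `O(log n · log (Δ W))` rounds: there are at
most `14 * log (Δ W)` levels, the potential is initially at most `B ^ K` with `log B ≤ 4 * log n`, and
`32 * (K * log B + c * log n)` iterations of four rounds bring its expectation below `n ^ (-c)`. -/
theorem le_measureReal_terminated (hN : Fintype.card V ≤ N) {c : ℝ} (hc : 1 ≤ c) :
    1 - 1 / (Fintype.card V : ℝ) ^ c ≤ (spannerAlgorithm.coinMeasure V N).real
      {ω | ∃ t : ℕ, (t : ℝ) ≤ (7192 + 256 * c) * Real.log (max (Fintype.card V : ℝ) 2) *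
          Real.log (max (net.maxDegree : ℝ) 2 * net.weightRatio) ∧
        spannerAlgorithm.AllTerminated net N ω t} := by
  set L := Real.log (max (net.maxDegree : ℝ) 2 * net.weightRatio) with hL
  set l := Real.log (max (Fintype.card V : ℝ) 2) with hl
  have hL2 : 1 / 2 ≤ L := log_max_mul_weightRatio_ge
  have hl2 : 1 / 2 ≤ l := half_le_log_max_two _
  have hlL : 1 / 4 ≤ l * L := by nlinarith
  have hprob : IsProbabilityMeasure (spannerAlgorithm.coinMeasure V N)  :=
    inferInstanceAs (IsProbabilityMeasure (uniformCoins V (16 * N ^ 2)))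
  rcases net.positiveWeights.eq_empty_or_nonempty with hP | hP
  · -- without positive weights, everything is covered at the start
    have hstart : (net.startState N).uncovered = ∅ := by
      by_contra hne
      obtain ⟨v, hv⟩ := near_nonempty_of_nonempty (N := N) uncovered_startState_subset
        (Finset.nonempty_iff_ne_empty.2 hne)
      obtain ⟨x, hx, -⟩ := exists_positiveWeight_le subset_rfl subset_rfl hv
      rw [hP] at hx
      exact hx
    have huniv : {ω : spannerAlgorithm.Coins V N | ∃ t : ℕ, (t : ℝ) ≤ (7192 + 256 * c) * l * L ∧
        spannerAlgorithm.AllTerminated net N ω t} = Set.univ := by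
      refine Set.eq_univ_of_forall fun ω => ⟨4 * 0 + 2, ?_,
        allTerminated_of_uncovered_eq_empty ω hstart⟩
      push_cast
      nlinarith
    rw [huniv, probReal_univ]
    have : (0 : ℝ) ≤ 1 / (Fintype.card V : ℝ) ^ c := by positivity
    linarith
  have hn : 1 ≤ Fintype.card V := by
    have := net.connected.nonempty
    exact Fintype.card_pos
  obtain ⟨j₀, K, hKle, hK⟩ := exists_levels hP
  set B := Fintype.card V * net.idEdges.card + 1 with hB
  have hn' : (1 : ℝ) ≤ Fintype.card V := by exact_mod_cast hn
  have hB1 : (1 : ℝ) ≤ B := by exact_mod_cast Nat.le_add_left 1 _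
  have hlogn : Real.log (Fintype.card V) ≤ l :=
    Real.log_le_log (by linarith) (le_max_left _ _)
  have hlogB : Real.log B ≤ 4 * l := by
    have h1 : (B : ℝ) ≤ max (Fintype.card V : ℝ) 2 ^ 4 := by
      have h2 : B ≤ Fintype.card V ^ 3 + 1 := by
        have := Nat.mul_le_mul_left (Fintype.card V) (card_idEdges_le (net := net))
        rw [hB, pow_succ' _ 2]
        omega
      have h3 : (B : ℝ) ≤ (Fintype.card V : ℝ) ^ 3 + 1 := by exact_mod_cast h2
      have h4 : (Fintype.card V : ℝ) ^ 3 ≤ max (Fintype.card V : ℝ) 2 ^ 3 := by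
        gcongr
        exact le_max_left _ _
      have h5 : (2 : ℝ) ≤ max (Fintype.card V : ℝ) 2 := le_max_right _ _
      have h6 : (1 : ℝ) ≤ max (Fintype.card V : ℝ) 2 ^ 3 := one_le_pow₀ (by linarith)
      calc (B : ℝ) ≤ max (Fintype.card V : ℝ) 2 ^ 3 * 2 := by linarith
        _ ≤ max (Fintype.card V : ℝ) 2 ^ 3 * max (Fintype.card V : ℝ) 2 := by gcongr
        _ = _ := by ring
    refine (Real.log_le_log (by linarith) h1).trans (le_of_eq ?_)
    rw [Real.log_pow]
    norm_num [hl]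
  have hKB : K * Real.log B ≤ 14 * L * (4 * l) :=
    mul_le_mul hKle hlogB (Real.log_nonneg hB1) (by linarith)
  have hcn : c * Real.log (Fintype.card V) ≤ c * l :=
    mul_le_mul_of_nonneg_left hlogn (by linarith)
  set T := ⌈32 * (K * Real.log B + c * Real.log (Fintype.card V))⌉₊ with hT
  have hT1 := Nat.le_ceil (32 * (K * Real.log B + c * Real.log (Fintype.card V)))
  have hT2 := Nat.ceil_lt_add_one
    (show 0 ≤ 32 * (K * Real.log B + c * Real.log (Fintype.card V)) by
      have := Real.log_nonneg hB1
      have := Real.log_nonneg hn'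
      positivity)
  rw [← hT] at hT1 hT2
  have hbad := (measureReal_uncovered_nonempty_le hN (hK N) T).trans (pow_mul_pow_le hn' hB1 hT1)
  have hcover : (Set.univ : Set (spannerAlgorithm.Coins V N)) ⊆
      {ω | ∃ t : ℕ, (t : ℝ) ≤ (7192 + 256 * c) * l * L ∧
        spannerAlgorithm.AllTerminated net N ω t} ∪
      {ω | (net.run N (coinRows ω) T).uncovered.Nonempty} := by
    intro ω _
    rcases (net.run N (coinRows ω) T).uncovered.eq_empty_or_nonempty with h0 | h0
    · refine Or.inl ⟨4 * T + 2, ?_, allTerminated_of_uncovered_eq_empty ω h0⟩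
      push_cast
      have h1 : c * l ≤ 2 * (c * l * L) := by
        have : 0 ≤ c * l := by positivity
        nlinarith
      nlinarith
    · exact Or.inr h0
  have h1 := (measureReal_mono (μ := spannerAlgorithm.coinMeasure V N) hcover).trans
    (measureReal_union_le _ _)
  rw [probReal_univ] at h1
  linarith

end WeightedNetwork
end

theorem mainTheorem8 :
    ∃ A : LocalAlgorithm,
      -- always: termination, and an `O(log Δ)`-approximation of the minimum weight 2-spanner
      (∃ C : ℝ, ∀ (V : Type) [Fintype V] (net : WeightedNetwork V) (N : ℕ),
        Fintype.card V ≤ N → ∀ ω : A.Coins V N,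
          (∃ t : ℕ, A.AllTerminated net N ω t) ∧
          ∀ t : ℕ, A.AllTerminated net N ω t →
            A.OutputsIncident net N ω t ∧
            IsKSpanner net.graph 2 (A.outputEdges net N ω t) ∧
            ∀ H : Finset (Sym2 V), IsKSpanner net.graph 2 H →
              net.cost (A.outputEdges net N ω t) ≤
                C * Real.log (max (net.maxDegree : ℝ) 2) * net.cost H) ∧
      -- with high probability: `O(log n · log (Δ W))` rounds
      (∀ (k : ℕ) (c : ℝ), 1 ≤ c → ∃ C : ℝ,
        ∀ (V : Type) [Fintype V] (net : WeightedNetwork V) (N : ℕ),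
          Fintype.card V ≤ N → N ≤ Fintype.card V ^ k →
            1 - 1 / (Fintype.card V : ℝ) ^ c ≤
              (A.coinMeasure V N).real
                {ω | ∃ t : ℕ,
                  (t : ℝ) ≤ C * Real.log (max (Fintype.card V : ℝ) 2) *
                    Real.log (max (net.maxDegree : ℝ) 2 * net.weightRatio) ∧
                  A.AllTerminated net N ω t}) := by
  refine ⟨spannerAlgorithm, ⟨192, fun V _ net N _ ω => ⟨?_, fun t ht => ⟨?_, ?_, ?_⟩⟩⟩,
    fun k c hc => ⟨7192 + 256 * c, fun V _ net N hN _ =>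
      WeightedNetwork.le_measureReal_terminated hN hc⟩⟩
  · obtain ⟨i, hi⟩ := WeightedNetwork.exists_uncovered_run_eq_empty (net := net) (N := N)
      (WeightedNetwork.coinRows ω)
    exact ⟨_, WeightedNetwork.allTerminated_of_uncovered_eq_empty ω hi⟩
  · intro v S hS
    rw [(WeightedNetwork.output_of_allTerminated ω ht).2 v, Option.some.injEq] at hS
    exact hS ▸ WeightedNetwork.chosen_run_subset _ _ _
  · exact WeightedNetwork.isKSpanner_outputEdges ht
  · exact fun H hH => WeightedNetwork.cost_outputEdges_le_mul_log ht hH
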